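/- Let $U$ be a finite-dimensional complex vector space with a nondegenerate Hermitian form $F$ of arbitrary signature, and let $\mathfrak{su}(U,F)$ be the real Lie algebra of trace-free $X\in\mathrm{End}_{\mathbb C}(U)$ with $F(Xu,v)+F(u,Xv)=0$ for all $u,v\in U$. Let $\mathfrak g$ be a real Lie algebra that is a finite direct sum of ideals, each isomorphic to some $\mathfrak{su}(p,q)$ with $p,q\ge 1$ or to some $\mathfrak{sp}(2m,\mathbb R)$ with $m\ge 1$, and let $\rho\colon\mathfrak g\to\mathfrak{su}(U,F)$ be a homomorphism of real Lie algebras. Then there is a decomposition $U=\bigoplus_{i=1}^n U_i$ into $\rho(\mathfrak g)$-invariant complex subspaces that are pairwise orthogonal for $F$ and such that $F_i:=F|_{U_i}$ is nondegenerate for every $i$, of some signature $(r_i,s_i)$, so that $(U_i,F_i)$ is isometric to $\mathbb C^{r_i+s_i}$ with its standard Hermitian form of signature $(r_i,s_i)$ and $\mathfrak{su}(U_i,F_i)\cong\mathfrak{su}(r_i,s_i)$. Moreover $\rho=\iota\circ(\rho^1,\dots,\rho^n)$, where $$(\rho^1,\dots,\rho^n)\colon\mathfrak g\to\bigoplus_{i=1}^n\mathfrak{su}(U_i,F_i),\qquad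 \iota\colon\bigoplus_{i=1}^n\mathfrak{su}(U_i,F_i)\hookrightarrow\mathfrak{su}(U,F)$$ are Lie algebra homomorphisms, $\iota$ is the injective block-diagonal inclusion and is holomorphic, and each $\rho^i$ is an irreducible complex representation on $U_i$ (that is, $U_i\ne 0$ and the only invariant complex subspaces are $0$ and $U_i$). One has $n=1$ if and only if $\rho$ is irreducible on $U$; in particular $n\ge 2$ if $U\neq 0$ and $\rho$ is reducible. Here a base point of the symmetric space of $\mathfrak{su}(U,F)$ is an orthogonal decomposition $U=U_+\oplus U_-$ with $F$ positive definite on $U_+$ and negative definite on $U_-$. It defines $\mathfrak{su}(U,F)=\mathfrak k\oplus\mathfrak p$, where $\mathfrak k$ consists of the elements preserving $U_+$ and $U_-$ and $\mathfrak p$ of those exchanging them, and the element $Z\in\mathfrak k$ acting as $\tfrac{is}{r+s}$ on $U_+$ and as $\tfrac{-ir}{r+s}$ on $U_-$ ($r=\dim U_+$, $s=\dim U_-$), for which $\mathrm{ad}\,Z$ is the complex structure on $\mathfrak p$. On $\bigoplus_i\mathfrak{su}(U_i,F_i)$ one takes $\mathfrak k,\mathfrak p,Z$ componentwise. That $\iota$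 is holomorphic means: for every choice of base points for the $\mathfrak{su}(U_i,F_i)$ there is a base point for $\mathfrak{su}(U,F)$ such that $\iota(\mathfrak k)\subset\mathfrak k$, $\iota(\mathfrak p)\subset\mathfrak p$ and $\iota([Z,X])=[Z,\iota(X)]$ for all $X\in\mathfrak p$. -/

import Mathlib

open scoped DirectSum ComplexConjugate

attribute [local instance 100] LieRing.ofAssociativeRing

namespace Hermitian

section Algebras

variable {U : Type*} [AddCommGroup U] [Module ℂ U]

/-- `su(U,F)`: the real Lie algebra of all trace-free complex-linear endomorphisms `X` of `U` with
`F(Xu,v) + F(u,Xv) = 0` for all `u, v`. -/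
def su (F : U →ₗ⋆[ℂ] U →ₗ[ℂ] ℂ) : LieSubalgebra ℝ (Module.End ℂ U) where
  carrier := {X | (∀ u v, F (X u) v + F u (X v) = 0) ∧ LinearMap.trace ℂ U X = 0}
  zero_mem' := by simp
  add_mem' := by
    rintro X Y ⟨hX, hX'⟩ ⟨hY, hY'⟩
    refine ⟨fun u v => ?_, by rw [map_add, hX', hY', add_zero]⟩
    have h1 := hX u v
    have h2 := hY u v
    simp only [LinearMap.add_apply, map_add]
    linear_combination h1 + h2
  smul_mem' := by
    rintro c X ⟨hX, hX'⟩
    have hc : c • X = (c : ℂ) • X := by ext u; simp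
    rw [hc]
    refine ⟨fun u v => ?_, by rw [map_smul, hX', smul_zero]⟩
    have h1 := hX u v
    simp only [LinearMap.smul_apply, map_smulₛₗ, Complex.conj_ofReal, smul_eq_mul]
    linear_combination (c : ℂ) * h1
  lie_mem' := by
    rintro X Y ⟨hX, -⟩ ⟨hY, -⟩
    refine ⟨fun u v => ?_, ?_⟩
    · have h1 := hX (Y u) v
      have h2 := hX u (Y v)
      have h3 := hY (X u) v
      have h4 := hY u (X v)
      simp only [Ring.lie_def, LinearMap.sub_apply, Module.End.mul_apply, map_sub]
      linear_combination h1 - h3 + h2 - h4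
    · rw [Ring.lie_def, map_sub, LinearMap.trace_mul_comm, sub_self]

/-- The standard Hermitian form of signature `(p,q)` on `ℂ^{p+q}`:
`F(x,y) = ∑_{i ≤ p} conj(x_i) y_i - ∑_{j ≤ q} conj(x_{p+j}) y_{p+j}`. -/
noncomputable def stdForm (p q : ℕ) :
    (Fin p ⊕ Fin q → ℂ) →ₗ⋆[ℂ] (Fin p ⊕ Fin q → ℂ) →ₗ[ℂ] ℂ :=
  LinearMap.mk₂'ₛₗ (starRingEnd ℂ) (RingHom.id ℂ)
    (fun x y => ∑ i, conj (x (Sum.inl i)) * y (Sum.inl i)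
      - ∑ j, conj (x (Sum.inr j)) * y (Sum.inr j))
    (fun x x' y => by
      simp only [Pi.add_apply, map_add, add_mul, Finset.sum_add_distrib]; ring)
    (fun c x y => by
      simp only [Pi.smul_apply, smul_eq_mul, map_mul, mul_assoc, ← Finset.mul_sum]; ring)
    (fun x y y' => by
      simp only [Pi.add_apply, mul_add, Finset.sum_add_distrib]; ring)
    (fun c x y => by
      simp only [Pi.smul_apply, smul_eq_mul, mul_left_comm _ c, ← Finset.mul_sum,
        RingHom.id_apply]; ring)

/-- `(U,F)` is isometric to `ℂ^{r+s}` with the standard form of signature `(r,s)`; such an isometry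
identifies `su(U,F)` with `su(r,s)`. -/
def HasSignature (F : U →ₗ⋆[ℂ] U →ₗ[ℂ] ℂ) (r s : ℕ) : Prop :=
  ∃ e : U ≃ₗ[ℂ] (Fin r ⊕ Fin s → ℂ), ∀ x y, F x y = stdForm r s (e x) (e y)

/-- The restriction of a sesquilinear form to a subspace. -/
abbrev restrict (F : U →ₗ⋆[ℂ] U →ₗ[ℂ] ℂ) (W : Submodule ℂ U) : W →ₗ⋆[ℂ] W →ₗ[ℂ] ℂ :=
  F.domRestrict₁₂ W W

/-- A real Lie algebra isomorphic to `su(p,q)` with `p, q ≥ 1`, or to `sp(2m,ℝ)` with `m ≥ 1`. -/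
def IsSuOrSp (L : Type*) [LieRing L] [LieAlgebra ℝ L] : Prop :=
  (∃ p q : ℕ, 1 ≤ p ∧ 1 ≤ q ∧ Nonempty (L ≃ₗ⁅ℝ⁆ su (stdForm p q))) ∨
    ∃ m : ℕ, 1 ≤ m ∧ Nonempty (L ≃ₗ⁅ℝ⁆ LieAlgebra.Symplectic.sp (Fin m) ℝ)

/-- A real Lie algebra which is the direct sum of finitely many ideals, each of them isomorphic to
some `su(p,q)` or some `sp(2m,ℝ)`. -/
def OnlySuSpFactors (L : Type*) [LieRing L] [LieAlgebra ℝ L] : Prop :=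
  ∃ (k : ℕ) (I : Fin k → LieIdeal ℝ L),
    DirectSum.IsInternal (fun i => (I i).toSubmodule) ∧ ∀ i, IsSuOrSp (I i)

/-- Irreducibility over `ℂ` of a homomorphism into `su(U,F)` viewed as a representation on `U`. -/
def IsIrreducibleRep {L : Type*} [LieRing L] [LieAlgebra ℝ L] {F : U →ₗ⋆[ℂ] U →ₗ[ℂ] ℂ}
    (ρ : L →ₗ⁅ℝ⁆ su F) : Prop :=
  Nontrivial U ∧ ∀ W : Submodule ℂ U,
    (∀ X : L, ∀ w ∈ W, (ρ X : Module.End ℂ U) w ∈ W) → W = ⊥ ∨ W = ⊤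

end Algebras

/-- A decomposition `L = 𝔨 + 𝔭` together with an element `Z` of the centre of `𝔨` such that
`ad Z` is a complex structure on `𝔭` (the tangent space of the symmetric space at the base
point fixed by `𝔨`). -/
structure HermitianDecomposition (L : Type*) [LieRing L] [LieAlgebra ℝ L] where
  /-- the subalgebra fixing the base point -/
  k : Submodule ℝ L
  /-- the tangent space at the base point -/
  p : Submodule ℝ L
  /-- the element inducing the complex structure -/
  Z : L
  isCompl : IsCompl k p
  lie_kk : ∀ X ∈ k, ∀ Y ∈ k, ⁅X, Y⁆ ∈ k
  lie_kp : ∀ X ∈ k, ∀ Y ∈ p, ⁅X, Y⁆ ∈ p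
  lie_pp : ∀ X ∈ p, ∀ Y ∈ p, ⁅X, Y⁆ ∈ k
  Z_mem : Z ∈ k
  lie_Z : ∀ X ∈ k, ⁅Z, X⁆ = 0
  lie_Z_Z : ∀ X ∈ p, ⁅Z, ⁅Z, X⁆⁆ = -X

/-- `f` respects the two decompositions, and its restriction `𝔭₁ → 𝔭₂` is complex linear. -/
def IsHolomorphicAt {L₁ L₂ : Type*} [LieRing L₁] [LieAlgebra ℝ L₁] [LieRing L₂] [LieAlgebra ℝ L₂]
    (D₁ : HermitianDecomposition L₁) (D₂ : HermitianDecomposition L₂) (f : L₁ →ₗ⁅ℝ⁆ L₂) : Prop :=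
  (∀ X ∈ D₁.k, f X ∈ D₂.k) ∧ (∀ X ∈ D₁.p, f X ∈ D₂.p) ∧
    ∀ X ∈ D₁.p, f ⁅D₁.Z, X⁆ = ⁅D₂.Z, f X⁆

section BasePoint

variable {U : Type*} [AddCommGroup U] [Module ℂ U]

/-- A point of the symmetric space of `SU(U,F)`: an orthogonal decomposition of `U` into a positive
definite and a negative definite subspace. -/
structure BasePoint (F : U →ₗ⋆[ℂ] U →ₗ[ℂ] ℂ) where
  /-- the positive definite subspace -/
  pos : Submodule ℂ U
  /-- the negative definite subspace -/
  neg : Submodule ℂ U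
  isCompl : IsCompl pos neg
  orthogonal : ∀ x ∈ pos, ∀ y ∈ neg, F x y = 0 ∧ F y x = 0
  pos_def : ∀ x ∈ pos, x ≠ 0 → 0 < (F x x).re
  neg_def : ∀ x ∈ neg, x ≠ 0 → (F x x).re < 0

namespace BasePoint

variable {F : U →ₗ⋆[ℂ] U →ₗ[ℂ] ℂ} (o : BasePoint F)

/-- The projection to the positive subspace along the negative one. -/
noncomputable def projPos : Module.End ℂ U := o.pos.projection o.neg o.isCompl

/-- The projection to the negative subspace along the positive one. -/
noncomputable def projNeg : Module.End ℂ U := o.neg.projection o.pos o.isCompl.symm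

/-- `+1` on the positive and `-1` on the negative subspace; `X ↦ σ X σ` is the Cartan involution. -/
noncomputable def σ : Module.End ℂ U := o.projPos - o.projNeg

/-- `i·s/(r+s)` on the positive and `-i·r/(r+s)` on the negative subspace, where `r` and `s` are
the dimensions of these subspaces. -/
noncomputable def zEnd : Module.End ℂ U :=
  (Complex.I * (Module.finrank ℂ o.neg / (Module.finrank ℂ o.pos + Module.finrank ℂ o.neg))) •
      o.projPos -
    (Complex.I * (Module.finrank ℂ o.pos / (Module.finrank ℂ o.pos + Module.finrank ℂ o.neg))) •
      o.projNeg

theorem projPos_add_projNeg : o.projPos + o.projNeg = 1 :=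
  Submodule.projection_add_projection_eq_id o.isCompl

theorem projPos_mul_projPos : o.projPos * o.projPos = o.projPos :=
  Submodule.isIdempotentElem_projection o.isCompl

theorem form_projPos (x y : U) : F (o.projPos x) y = F x (o.projPos y) := by
  have hx : x = o.projPos x + o.projNeg x := (LinearMap.congr_fun o.projPos_add_projNeg x).symm
  have hy : y = o.projPos y + o.projNeg y := (LinearMap.congr_fun o.projPos_add_projNeg y).symm
  have px : ∀ x, o.projPos x ∈ o.pos := Submodule.projection_apply_mem o.isCompl
  have nx : ∀ x, o.projNeg x ∈ o.neg := Submodule.projection_apply_mem o.isCompl.symm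
  have e1 : F (o.projPos x) y = F (o.projPos x) (o.projPos y) := by
    conv_lhs => rw [hy, map_add, (o.orthogonal _ (px x) _ (nx y)).1, add_zero]
  have e2 : F x (o.projPos y) = F (o.projPos x) (o.projPos y) := by
    conv_lhs => rw [hx, map_add, LinearMap.add_apply, (o.orthogonal _ (px y) _ (nx x)).2, add_zero]
  rw [e1, e2]

theorem projNeg_eq : o.projNeg = 1 - o.projPos := eq_sub_of_add_eq' o.projPos_add_projNeg

theorem σ_eq : o.σ = (2 : ℂ) • o.projPos - 1 := by
  rw [σ, projNeg_eq, two_smul]; abel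

theorem σ_mul_σ : o.σ * o.σ = 1 := by
  have h := o.projPos_mul_projPos
  rw [σ, projNeg_eq]
  simp only [mul_sub, sub_mul, h, mul_one, one_mul]
  abel

theorem form_σ (x y : U) : F (o.σ x) y = F x (o.σ y) := by
  have := o.form_projPos x y
  simp only [σ_eq, LinearMap.sub_apply, LinearMap.smul_apply, Module.End.one_apply, map_sub,
    map_smulₛₗ, smul_eq_mul, Complex.conj_ofNat, RingHom.id_apply]
  linear_combination 2 * this

theorem conj_σ_mem {X : Module.End ℂ U} (hX : X ∈ su F) : o.σ * X * o.σ ∈ su F := by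
  refine ⟨fun u v => ?_, ?_⟩
  · simp only [Module.End.mul_apply]
    rw [o.form_σ, ← o.form_σ u]
    exact hX.1 _ _
  · rw [mul_assoc, LinearMap.trace_mul_comm, mul_assoc, o.σ_mul_σ, mul_one]
    exact hX.2

variable [FiniteDimensional ℂ U]

theorem trace_projection {p q : Submodule ℂ U} (h : IsCompl p q) :
    LinearMap.trace ℂ U (p.projection q h) = Module.finrank ℂ p :=
  LinearMap.IsProj.trace
    ⟨Submodule.projection_apply_mem h, fun _ hx => Submodule.projection_apply_of_mem_left h hx⟩

theorem zEnd_mem : o.zEnd ∈ su F := by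
  refine ⟨fun u v => ?_, ?_⟩
  · have h := o.form_projPos u v
    simp only [zEnd, projNeg_eq, LinearMap.sub_apply, LinearMap.smul_apply, map_sub,
      map_smulₛₗ, smul_eq_mul, map_mul, map_div₀, map_add, Complex.conj_natCast,
      Complex.conj_I, Module.End.one_apply, RingHom.id_apply, h]
    ring
  · rw [zEnd, map_sub, map_smul, map_smul, projPos, projNeg, trace_projection, trace_projection,
      smul_eq_mul, smul_eq_mul]
    ring

/-- The element `Z` of `su(U,F)` inducing the complex structure at the base point. -/
noncomputable def Z : su F := ⟨o.zEnd, o.zEnd_mem⟩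

/-- Bracketing with `Z` is bracketing with `(i/2)σ`. -/
theorem zEnd_lie (X : Module.End ℂ U) :
    o.zEnd * X - X * o.zEnd = (Complex.I / 2) • (o.σ * X - X * o.σ) := by
  rcases subsingleton_or_nontrivial U with hU | hU
  · exact Subsingleton.elim _ _
  have hd : (Module.finrank ℂ o.pos + Module.finrank ℂ o.neg : ℂ) ≠ 0 := by
    have h := Submodule.finrank_add_eq_of_isCompl o.isCompl
    have h' : 0 < Module.finrank ℂ U := Module.finrank_pos
    exact_mod_cast (h ▸ h'.ne' : Module.finrank ℂ o.pos + Module.finrank ℂ o.neg ≠ 0)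
  have hz : o.zEnd = Complex.I • o.projPos -
      (Complex.I * (Module.finrank ℂ o.pos /
        (Module.finrank ℂ o.pos + Module.finrank ℂ o.neg))) • (1 : Module.End ℂ U) := by
    rw [zEnd, projNeg_eq, smul_sub, sub_sub_eq_add_sub, add_sub_right_comm, ← add_sub_right_comm,
      ← add_smul]
    congr 2
    rw [← mul_add, ← add_div, add_comm (Module.finrank ℂ o.neg : ℂ), div_self hd, mul_one]
  rw [hz, σ_eq]
  simp only [sub_mul, mul_sub, smul_mul_assoc, mul_smul_comm, one_mul, mul_one, smul_sub, smul_smul]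
  rw [div_mul_cancel₀ _ (two_ne_zero)]
  abel

/-- The decomposition of `su(U,F)` at a base point: `𝔨` consists of the `X` which preserve the
positive and the negative subspace (equivalently, commute with `σ`), and `𝔭` of the `X` which
exchange them (equivalently, anticommute with `σ`). -/
noncomputable def decomposition : HermitianDecomposition (su F) where
  k :=
    { carrier := {X | o.σ * (X : Module.End ℂ U) = X * o.σ}
      zero_mem' := by simp
      add_mem' := fun {X Y} hX hY => by
        simp only [Set.mem_ofPred_eq] at hX hY ⊢
        simp [mul_add, add_mul, hX, hY]
      smul_mem' := fun c X hX => by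
        simp only [Set.mem_ofPred_eq] at hX ⊢
        simp [hX] }
  p :=
    { carrier := {X | o.σ * (X : Module.End ℂ U) = -(X * o.σ)}
      zero_mem' := by simp
      add_mem' := fun {X Y} hX hY => by
        simp only [Set.mem_ofPred_eq] at hX hY ⊢
        rw [AddMemClass.coe_add, mul_add, add_mul, hX, hY, neg_add]
      smul_mem' := fun c X hX => by
        simp only [Set.mem_ofPred_eq] at hX ⊢
        simp [hX] }
  Z := o.Z
  isCompl := by
    have hs := o.σ_mul_σ
    rw [isCompl_iff, Submodule.disjoint_def, codisjoint_iff, Submodule.eq_top_iff']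
    constructor
    · rintro ⟨X, hX⟩ h1 h2
      change o.σ * X = X * o.σ at h1
      change o.σ * X = -(X * o.σ) at h2
      have h3 : X * o.σ = 0 := by
        have h := h1.symm.trans h2
        rw [eq_neg_iff_add_eq_zero, ← two_smul ℂ] at h
        exact (smul_eq_zero_iff_right two_ne_zero).mp h
      have h4 : X = 0 := by rw [← mul_one X, ← hs, ← mul_assoc, h3, zero_mul]
      exact Subtype.ext h4
    · intro X
      let T : su F := ⟨o.σ * X * o.σ, o.conj_σ_mem X.2⟩
      have e1 : o.σ * (o.σ * (X : Module.End ℂ U) * o.σ) = X * o.σ := by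
        rw [← mul_assoc, ← mul_assoc, hs, one_mul]
      have e2 : o.σ * (X : Module.End ℂ U) * o.σ * o.σ = o.σ * X := by
        rw [mul_assoc, hs, mul_one]
      refine Submodule.mem_sup.2 ⟨(1 / 2 : ℝ) • (X + T), ?_, (1 / 2 : ℝ) • (X - T), ?_, ?_⟩
      · refine Submodule.smul_mem _ _ ?_
        change o.σ * ((X : Module.End ℂ U) + o.σ * X * o.σ) = (X + o.σ * X * o.σ) * o.σ
        rw [mul_add, add_mul, e1, e2, add_comm]
      · refine Submodule.smul_mem _ _ ?_
        change o.σ * ((X : Module.End ℂ U) - o.σ * X * o.σ) = -((X - o.σ * X * o.σ) * o.σ)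
        rw [mul_sub, sub_mul, e1, e2, neg_sub]
      · rw [← smul_add, add_add_sub_cancel, ← two_smul ℝ X, smul_smul]
        norm_num
  lie_kk := by
    rintro ⟨X, hX⟩ h1 ⟨Y, hY⟩ h2
    change o.σ * X = X * o.σ at h1
    change o.σ * Y = Y * o.σ at h2
    change o.σ * (X * Y - Y * X) = (X * Y - Y * X) * o.σ
    rw [mul_sub, sub_mul, ← mul_assoc, ← mul_assoc, h1, h2, mul_assoc, mul_assoc, h1, h2,
      mul_assoc, mul_assoc]
  lie_kp := by
    rintro ⟨X, hX⟩ h1 ⟨Y, hY⟩ h2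
    change o.σ * X = X * o.σ at h1
    change o.σ * Y = -(Y * o.σ) at h2
    change o.σ * (X * Y - Y * X) = -((X * Y - Y * X) * o.σ)
    rw [mul_sub, sub_mul, ← mul_assoc, ← mul_assoc, h1, h2, mul_assoc, neg_mul, mul_assoc, h1, h2,
      mul_neg, mul_assoc, mul_assoc]
    abel
  lie_pp := by
    rintro ⟨X, hX⟩ h1 ⟨Y, hY⟩ h2
    change o.σ * X = -(X * o.σ) at h1
    change o.σ * Y = -(Y * o.σ) at h2
    change o.σ * (X * Y - Y * X) = (X * Y - Y * X) * o.σ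
    rw [mul_sub, sub_mul, ← mul_assoc, ← mul_assoc, h1, h2, neg_mul, neg_mul, mul_assoc, mul_assoc,
      h1, h2, mul_neg, mul_neg, neg_neg, neg_neg, mul_assoc, mul_assoc]
  Z_mem := by
    have h := o.zEnd_lie o.σ
    rw [sub_self, smul_zero, sub_eq_zero] at h
    exact h.symm
  lie_Z := by
    rintro ⟨X, hX⟩ h1
    change o.σ * X = X * o.σ at h1
    refine Subtype.ext ?_
    change o.zEnd * X - X * o.zEnd = 0
    rw [o.zEnd_lie, h1, sub_self, smul_zero]
  lie_Z_Z := by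
    have key : ∀ X : Module.End ℂ U, o.σ * X = -(X * o.σ) →
        o.zEnd * X - X * o.zEnd = Complex.I • (o.σ * X) := by
      intro X h
      rw [o.zEnd_lie, ← neg_eq_iff_eq_neg.mpr h, sub_neg_eq_add, ← two_smul ℂ, smul_smul,
        div_mul_cancel₀ _ two_ne_zero]
    rintro ⟨X, hX⟩ h1
    change o.σ * X = -(X * o.σ) at h1
    refine Subtype.ext ?_
    change o.zEnd * (o.zEnd * X - X * o.zEnd) - (o.zEnd * X - X * o.zEnd) * o.zEnd = -X
    have h2 : o.σ * (Complex.I • (o.σ * X)) = -(Complex.I • (o.σ * X) * o.σ) := by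
      rw [mul_smul_comm, smul_mul_assoc, ← smul_neg, mul_assoc, ← mul_neg, ← h1]
    rw [key X h1, key _ h2, mul_smul_comm, ← mul_assoc, o.σ_mul_σ, one_mul, smul_smul,
      Complex.I_mul_I, neg_one_smul]

end BasePoint

end BasePoint

/-- The product decomposition of a finite direct sum. -/
def HermitianDecomposition.directSum {n : ℕ} {L : Fin n → Type*} [∀ i, LieRing (L i)]
    [∀ i, LieAlgebra ℝ (L i)] (D : ∀ i, HermitianDecomposition (L i)) :
    HermitianDecomposition (⨁ i, L i) where
  k :=
    { carrier := {X | ∀ i, X i ∈ (D i).k}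
      zero_mem' := fun i => (D i).k.zero_mem
      add_mem' := fun hX hY i => (D i).k.add_mem (hX i) (hY i)
      smul_mem' := fun c _ hX i => (D i).k.smul_mem c (hX i) }
  p :=
    { carrier := {X | ∀ i, X i ∈ (D i).p}
      zero_mem' := fun i => (D i).p.zero_mem
      add_mem' := fun hX hY i => (D i).p.add_mem (hX i) (hY i)
      smul_mem' := fun c _ hX i => (D i).p.smul_mem c (hX i) }
  Z := DFinsupp.equivFunOnFintype.symm fun i => (D i).Z
  isCompl := by
    rw [isCompl_iff, Submodule.disjoint_def, codisjoint_iff, Submodule.eq_top_iff']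
    constructor
    · intro X h1 h2
      refine DFinsupp.ext fun i => ?_
      exact Submodule.disjoint_def.1 (D i).isCompl.disjoint _ (h1 i) (h2 i)
    · intro X
      have h : ∀ i, ∃ y ∈ (D i).k, ∃ z ∈ (D i).p, y + z = X i := fun i =>
        Submodule.mem_sup.1 ((D i).isCompl.sup_eq_top ▸ Submodule.mem_top)
      choose y hy z hz hyz using h
      exact Submodule.mem_sup.2 ⟨DFinsupp.equivFunOnFintype.symm y, hy,
        DFinsupp.equivFunOnFintype.symm z, hz, DFinsupp.ext hyz⟩
  lie_kk X hX Y hY i := by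
    rw [DirectSum.bracket_apply]; exact (D i).lie_kk _ (hX i) _ (hY i)
  lie_kp X hX Y hY i := by
    rw [DirectSum.bracket_apply]; exact (D i).lie_kp _ (hX i) _ (hY i)
  lie_pp X hX Y hY i := by
    rw [DirectSum.bracket_apply]; exact (D i).lie_pp _ (hX i) _ (hY i)
  Z_mem i := (D i).Z_mem
  lie_Z X hX := by
    refine DFinsupp.ext fun i => ?_
    rw [DirectSum.bracket_apply]; exact (D i).lie_Z _ (hX i)
  lie_Z_Z X hX := by
    refine DFinsupp.ext fun i => ?_
    rw [DirectSum.bracket_apply, DirectSum.bracket_apply]; exact (D i).lie_Z_Z _ (hX i)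

end Hermitian

/-!
Let `𝔤 = 𝔨 + 𝔭` be a Cartan decomposition and `Z` an element of the centre of `𝔨` for which `ad Z`
is a complex structure on `𝔭`. Such data exist on `su(p, q)` and `sp(2m, ℝ)`, hence on their
finite direct sums (`CartanData`). The only point that is not formal is that `U` has an irreducible
subrepresentation on which `F` is nondegenerate: its orthogonal complement is again nondegenerate
and invariant, so the decomposition follows by induction on the dimension
(`CompactFrame.exists_orthogonal_decomposition`).

The elements of `𝔨` and `i𝔭` span the compact dual of `𝔤`, on which all representations are
unitary. This is shown without compact groups. In an orthonormal basis of the compact dual the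
structure constants are totally antisymmetric (`IsCompactSemisimple`). For an irreducible
representation, a tuple of representing matrices of minimal norm in its conjugacy class exists by
compactness (`exists_minimal_conjugate`). The moment map `∑ [B, Bᴴ]` vanishes at such a tuple
(`sum_commutator_conjTranspose_eq_zero`), which forces every `B + Bᴴ` to commute with the
representation (`commute_add_conjTranspose`). By Schur's lemma it is a scalar, of trace zero, so
all the `B` are skew-Hermitian. With the Casimir operator this gives the vanishing of the first
cohomology (`IsRep.exists_eq_apply_of_cocycle`), then complete reducibility, and thus a positive
definite Hermitian form `h` on every representation, for which `ρ(𝔨)` is skew and `ρ(𝔭)` is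
symmetric (`IsRep.exists_inner`).

Write `F(u, v) = h(A u, v)`. As `ρ(𝔤)` is skew for `F`, the operator `A` commutes with `ρ(𝔨)` and
anticommutes with `ρ(𝔭)`. Since `(ad Z)² = -1` on `𝔭`, so does `τ = exp (π ρ(Z))`
(`anticomm_of_lie_lie`). Hence `τ⁻¹ A` commutes with `ρ(𝔤)`, and its eigenspaces are invariant. On
a minimal invariant subspace `W` of an eigenspace, with eigenvalue `z ≠ 0`, one has
`F(w, τ w) = conj z * h(τ w, τ w) ≠ 0` for `w ≠ 0`, and `τ w ∈ W`. So `F` is nondegenerate on `W`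
(`CompactFrame.exists_irreducible_nondegenerate`).

The restrictions of `ρ` to the summands have trace zero because `𝔤` is perfect. For base points
of the summands, the positive and the negative subspaces add up to a base point of `U` whose
operator `σ` is block diagonal. The bracket with `Z` is the bracket with `(i/2)σ`, although `Z`
itself need not have the blocks `Zᵢ`, so the block-diagonal inclusion is holomorphic
(`isHolomorphicAt_blockInclusion`).
-/

namespace Hermitian

universe u

/-! ### Compact structure constants and their representations -/

/-- The structure constants of a compact semisimple real Lie algebra in a basis which is
orthonormal for an invariant inner product: they are totally antisymmetric, and the centre is
zero (equivalently, by antisymmetry, every linear functional vanishing on brackets is zero). -/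
structure IsCompactSemisimple {ι : Type*} [Fintype ι] (c : ι → ι → ι → ℝ) : Prop where
  swap_left : ∀ a b d, c b a d = -c a b d
  swap_right : ∀ a b d, c a d b = -c a b d
  eq_zero_of_forall : ∀ t : ι → ℂ, (∀ a b, ∑ d, (c a b d : ℂ) * t d = 0) → t = 0

/-- The family `T` in an associative algebra satisfies the commutation relations with structure
constants `c`. -/
def IsRep {ι : Type*} [Fintype ι] {R : Type*} [Ring R] [Module ℂ R] (c : ι → ι → ι → ℝ)
    (T : ι → R) : Prop :=
  ∀ a b, T a * T b - T b * T a = ∑ d, (c a b d : ℂ) • T d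

/-- The only subspaces invariant under the family `T` are `0` and the whole space, which is
nonzero. -/
def IsIrreducibleFamily {ι V : Type*} [AddCommGroup V] [Module ℂ V] (T : ι → Module.End ℂ V) :
    Prop :=
  Nontrivial V ∧ ∀ W : Submodule ℂ V, (∀ a, ∀ w ∈ W, T a w ∈ W) → W = ⊥ ∨ W = ⊤

/-- A positive definite Hermitian form. -/
structure IsInner {V : Type*} [AddCommGroup V] [Module ℂ V] (h : V →ₗ⋆[ℂ] V →ₗ[ℂ] ℂ) : Prop where
  conj_symm : ∀ x y, conj (h x y) = h y x
  pos : ∀ x, x ≠ 0 → 0 < (h x x).re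

/-- Schur's lemma. -/
theorem IsIrreducibleFamily.exists_eq_smul_one {ι V : Type*} [AddCommGroup V] [Module ℂ V]
    [FiniteDimensional ℂ V] {T : ι → Module.End ℂ V} (hT : IsIrreducibleFamily T)
    {S : Module.End ℂ V} (hS : ∀ a, S * T a = T a * S) : ∃ z : ℂ, S = z • 1 := by
  have := hT.1
  obtain ⟨z, hz⟩ := Module.End.exists_eigenvalue S
  refine ⟨z, ?_⟩
  have hinv : ∀ a, ∀ w ∈ S.eigenspace z, T a w ∈ S.eigenspace z := by
    intro a w hw
    rw [Module.End.mem_eigenspace_iff] at hw ⊢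
    rw [← Module.End.mul_apply, hS, Module.End.mul_apply, hw, map_smul]
  rcases hT.2 _ hinv with h | h
  · exact absurd h hz
  · ext w
    have : w ∈ S.eigenspace z := h ▸ Submodule.mem_top
    simpa [Module.End.mem_eigenspace_iff] using this

/-! ### Tuples of matrices of minimal norm in their conjugacy class -/

section Minimal

open Matrix

attribute [local instance] Matrix.frobeniusNormedAddCommGroup Matrix.frobeniusNormedSpace
  Matrix.frobeniusNormedRing Matrix.frobeniusNormedAlgebra

variable {ι n : Type*} [Fintype n] [DecidableEq n]

theorem frobenius_norm_sq (X : Matrix n n ℂ) : ‖X‖ ^ 2 = (trace (X * Xᴴ)).re := by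
  rw [Matrix.frobenius_norm_def, ← Real.sqrt_eq_rpow, Real.sq_sqrt (by positivity)]
  simp only [trace, diag_apply, mul_apply, conjTranspose_apply, Complex.re_sum, Real.rpow_ofNat]
  refine Finset.sum_congr rfl fun i _ => Finset.sum_congr rfl fun j _ => ?_
  rw [← Complex.ofReal_re (‖X i j‖ ^ 2)]
  congr 1
  push_cast
  exact (RCLike.mul_conj (X i j)).symm

/-- A matrix intertwining an irreducible family with another family is invertible. -/
theorem isUnit_of_intertwining {A : ι → Matrix n n ℂ}
    (hA : IsIrreducibleFamily fun a => (A a).toLin') {B : ι → Matrix n n ℂ} {g : Matrix n n ℂ}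
    (hg : g ≠ 0) (h : ∀ a, g * A a = B a * g) : IsUnit g := by
  have key := hA.2 (LinearMap.ker g.toLin') fun a w hw => by
    simp only [LinearMap.mem_ker, toLin'_apply, mulVec_mulVec] at hw ⊢
    rw [h, ← mulVec_mulVec, hw, mulVec_zero]
  rcases key with key | key
  · rw [← Matrix.mulVec_injective_iff_isUnit]
    exact LinearMap.ker_eq_bot.1 key
  · refine absurd ?_ hg
    have := LinearMap.ker_eq_top.1 key
    simpa using this

variable [Fintype ι]

/-- In the conjugacy class of an irreducible tuple of matrices some tuple has minimal norm. -/
theorem exists_minimal_conjugate {A : ι → Matrix n n ℂ}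
    (hA : IsIrreducibleFamily fun a => (A a).toLin') :
    ∃ (g : Matrix n n ℂ) (B : ι → Matrix n n ℂ), IsUnit g ∧ (∀ a, g * A a = B a * g) ∧
      ∀ p : Matrix n n ℂ, IsUnit p → ∑ a, ‖B a‖ ^ 2 ≤ ∑ a, ‖p * B a * p⁻¹‖ ^ 2 := by
  have hnt : Nontrivial (Matrix n n ℂ) := by
    have := hA.1
    refine ⟨1, 0, fun h => ?_⟩
    obtain ⟨v, hv⟩ := exists_ne (0 : n → ℂ)
    refine hv ?_
    rw [← one_mulVec v, h, zero_mulVec]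
  -- pairs `(g, B)` with `g` intertwining `A` and `B`; the normalisation of `g` loses nothing
  -- since conjugation is insensitive to scalars
  let K : Set (Matrix n n ℂ × (ι → Matrix n n ℂ)) :=
    {x | ‖x.1‖ = 1 ∧ (∀ a, x.1 * A a = x.2 a * x.1)} ∩ {x | ∑ a, ‖x.2 a‖ ^ 2 ≤ ∑ a, ‖A a‖ ^ 2}
  have hmem : ∀ (g : Matrix n n ℂ) (B : ι → Matrix n n ℂ), g ≠ 0 →
      (∀ a, g * A a = B a * g) → ∑ a, ‖B a‖ ^ 2 ≤ ∑ a, ‖A a‖ ^ 2 →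
      (((‖g‖⁻¹ : ℝ) : ℂ) • g, B) ∈ K := by
    intro g B hg h1 h2
    refine ⟨⟨?_, fun a => ?_⟩, h2⟩
    · rw [norm_smul, Complex.norm_real, norm_inv, norm_norm,
        inv_mul_cancel₀ (norm_ne_zero_iff.2 hg)]
    · simp only [smul_mul_assoc, mul_smul_comm, h1]
  have hcl : IsClosed K := by
    refine IsClosed.inter (IsClosed.inter ?_ ?_) ?_
    · exact isClosed_eq (by fun_prop) (by fun_prop)
    · change IsClosed {x : Matrix n n ℂ × (ι → Matrix n n ℂ) | ∀ a, x.1 * A a = x.2 a * x.1}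
      rw [Set.ofPred_forall]
      exact isClosed_iInter fun a => isClosed_eq (by fun_prop) (by fun_prop)
    · exact isClosed_le (by fun_prop) (by fun_prop)
  have : ProperSpace (Matrix n n ℂ) := FiniteDimensional.proper ℂ _
  have hK : IsCompact K := by
    refine ((isCompact_closedBall (0 : Matrix n n ℂ) 1).prod (isCompact_univ_pi fun _ : ι =>
      isCompact_closedBall (0 : Matrix n n ℂ) (√(∑ a, ‖A a‖ ^ 2)))).of_isClosed_subset hcl ?_
    rintro ⟨g, B⟩ ⟨⟨h1, -⟩, h2⟩
    refine ⟨mem_closedBall_zero_iff.2 (le_of_eq h1), fun a _ => mem_closedBall_zero_iff.2 ?_⟩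
    refine Real.le_sqrt_of_sq_le (le_trans ?_ h2)
    exact Finset.single_le_sum (f := fun a => ‖B a‖ ^ 2) (fun a _ => by positivity)
      (Finset.mem_univ a)
  obtain ⟨⟨g, B⟩, hgB, hmin⟩ := hK.exists_isMinOn
    ⟨_, hmem 1 A one_ne_zero (fun a => by rw [one_mul, mul_one]) le_rfl⟩
    (f := fun x => ∑ a, ‖x.2 a‖ ^ 2) (by fun_prop)
  have hmin' : ∀ y ∈ K, ∑ a, ‖B a‖ ^ 2 ≤ ∑ a, ‖y.2 a‖ ^ 2 := fun y hy => hmin hy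
  have hg0 : g ≠ 0 := by
    rintro rfl
    have := hgB.1.1
    simp at this
  have hg := isUnit_of_intertwining hA hg0 hgB.1.2
  refine ⟨g, B, hg, hgB.1.2, fun p hp => ?_⟩
  by_cases hle : ∑ a, ‖p * B a * p⁻¹‖ ^ 2 ≤ ∑ a, ‖A a‖ ^ 2
  · have hint : ∀ a, p * g * A a = p * B a * p⁻¹ * (p * g) := by
      intro a
      rw [mul_assoc, hgB.1.2, mul_assoc (p * B a), ← mul_assoc p⁻¹, nonsing_inv_mul _
        ((isUnit_iff_isUnit_det p).1 hp), one_mul, mul_assoc]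
    have := hmin' _ (hmem (p * g) (fun a => p * B a * p⁻¹) (hp.mul hg).ne_zero hint hle)
    exact this
  · exact le_trans hgB.2 (le_of_not_ge hle)

theorem trace_mul_commutator {n : Type*} [Fintype n] (X Y Z : Matrix n n ℂ) :
    trace (X * (Z * Y - Y * Z)) = trace ((Y * X - X * Y) * Z) := by
  rw [mul_sub, sub_mul, trace_sub, trace_sub, ← mul_assoc, trace_mul_comm _ Y, ← mul_assoc,
    ← mul_assoc]

theorem hasDerivAt_exp_conj {R : Type*} [NormedRing R] [NormedAlgebra ℝ R] [CompleteSpace R]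
    (L : R →L[ℝ] ℝ) (M b b' : R) :
    HasDerivAt (fun t : ℝ => L (NormedSpace.exp (t • M) * b * NormedSpace.exp (t • (-M)) * b'))
      (L ((M * b - b * M) * b')) 0 := by
  have h1 : ∀ N : R, HasDerivAt (fun t : ℝ => NormedSpace.exp (t • N)) N 0 := by
    intro N
    simpa using hasDerivAt_exp_smul_const (𝕂 := ℝ) N (0 : ℝ)
  have h2 := L.hasFDerivAt.comp_hasDerivAt _ ((((h1 M).mul_const b).mul (h1 (-M))).mul_const b')
  refine h2.congr_deriv ?_
  simp [sub_eq_add_neg]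

/-- At a tuple of minimal norm in its conjugacy class the moment map vanishes. -/
theorem sum_commutator_conjTranspose_eq_zero {B : ι → Matrix n n ℂ}
    (hB : ∀ p : Matrix n n ℂ, IsUnit p → ∑ a, ‖B a‖ ^ 2 ≤ ∑ a, ‖p * B a * p⁻¹‖ ^ 2) :
    ∑ a, (B a * (B a)ᴴ - (B a)ᴴ * B a) = 0 := by
  set M := ∑ a, (B a * (B a)ᴴ - (B a)ᴴ * B a) with hM
  have hMh : Mᴴ = M := by
    simp only [hM, conjTranspose_sum, conjTranspose_sub, conjTranspose_mul,
      conjTranspose_conjTranspose]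
  -- the squared norm along the conjugates by the positive matrices `exp (t M / 2)`
  let f : ℝ → ℝ := fun t => (∑ a, trace (NormedSpace.exp (t • M) * B a *
    NormedSpace.exp (t • (-M)) * (B a)ᴴ)).re
  have hf : ∀ t, f t = ∑ a, ‖NormedSpace.exp ((t / 2) • M) * B a *
      (NormedSpace.exp ((t / 2) • M))⁻¹‖ ^ 2 := by
    intro t
    have hu : NormedSpace.exp (t • M) =
        NormedSpace.exp ((t / 2) • M) * NormedSpace.exp ((t / 2) • M) := by
      rw [← Matrix.exp_add_of_commute _ _ (Commute.refl _), ← add_smul, add_halves]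
    have hu' : NormedSpace.exp (t • (-M)) =
        (NormedSpace.exp ((t / 2) • M))⁻¹ * (NormedSpace.exp ((t / 2) • M))⁻¹ := by
      rw [smul_neg, Matrix.exp_neg, hu, Matrix.mul_inv_rev]
    have hh : (NormedSpace.exp ((t / 2) • M))ᴴ = NormedSpace.exp ((t / 2) • M) := by
      rw [← Matrix.exp_conjTranspose, conjTranspose_smul, hMh]; simp
    simp only [f, Complex.re_sum, frobenius_norm_sq, hu, hu', conjTranspose_mul,
      conjTranspose_nonsing_inv, hh]
    refine Finset.sum_congr rfl fun a _ => ?_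
    congr 1
    rw [trace_mul_comm (_ * B a * _) _]
    simp only [mul_assoc]
    rw [trace_mul_comm]
    simp only [mul_assoc]
    rw [trace_mul_comm]
    simp only [mul_assoc]
  have hmin : IsLocalMin f 0 := by
    refine Filter.Eventually.of_forall fun t => ?_
    rw [hf t, hf 0]
    simpa using hB _ (Matrix.isUnit_exp _)
  have hderiv : HasDerivAt f (trace (M * M)).re 0 := by
    let L : Matrix n n ℂ →L[ℝ] ℝ := LinearMap.toContinuousLinearMap
      (Complex.reLm ∘ₗ (Matrix.traceLinearMap n ℝ ℂ))
    have hL : ∀ X, L X = (trace X).re := fun X => rfl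
    have h3 := HasDerivAt.fun_sum (u := Finset.univ) fun a _ =>
      hasDerivAt_exp_conj L M (B a) ((B a)ᴴ)
    have hfL : f = fun t => ∑ a, L (NormedSpace.exp (t • M) * B a *
        NormedSpace.exp (t • (-M)) * (B a)ᴴ) := by
      ext t
      simp only [f, hL, Complex.re_sum]
    rw [hfL]
    refine h3.congr_deriv (Eq.symm ?_)
    · change (trace (M * M)).re = ∑ a, (trace ((M * B a - B a * M) * (B a)ᴴ)).re
      rw [← Complex.re_sum]
      conv_lhs => rw [hM]
      rw [Finset.sum_mul, trace_sum]
      congr 1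
      refine Finset.sum_congr rfl fun a _ => ?_
      rw [← trace_mul_commutator, trace_mul_comm]
  have h0 := hmin.hasDerivAt_eq_zero hderiv
  have : ‖M‖ ^ 2 = 0 := by rw [frobenius_norm_sq, hMh, h0]
  simpa using this

/-- If a representation of a compact Lie algebra satisfies the moment map equation, then the
`B j + (B j)ᴴ` commute with it. With `D j i = [(B j)ᴴ + B j, B i]`, the structure constants being
antisymmetric, `∑ ‖D j i‖²` is the trace of `∑ i, (∑ j, [[B j, (B j)ᴴ], B i]) (B i)ᴴ`, which is
zero. -/
theorem commute_add_conjTranspose {c : ι → ι → ι → ℝ} (hc : IsCompactSemisimple c)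
    {B : ι → Matrix n n ℂ} (hB : IsRep c B)
    (hM : ∑ a, (B a * (B a)ᴴ - (B a)ᴴ * B a) = 0) (j i : ι) :
    ((B j)ᴴ + B j) * B i = B i * ((B j)ᴴ + B j) := by
  let D : ι → ι → Matrix n n ℂ := fun j i => ((B j)ᴴ + B j) * B i - B i * ((B j)ᴴ + B j)
  have hD : ∀ j i, D j i = ((B j)ᴴ * B i - B i * (B j)ᴴ) + ∑ k, (c j i k : ℂ) • B k := by
    intro j i
    rw [← hB j i]
    simp only [D]
    noncomm_ring
  have hDD : ∀ j i, ∑ k, (c j i k : ℂ) • D j k =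
      ((B j)ᴴ + B j) * (B j * B i - B i * B j) - (B j * B i - B i * B j) * ((B j)ᴴ + B j) := by
    intro j i
    rw [hB j i, Finset.mul_sum, Finset.sum_mul, ← Finset.sum_sub_distrib]
    refine Finset.sum_congr rfl fun k _ => ?_
    simp only [D, smul_sub, mul_smul_comm, smul_mul_assoc]
  have hND : ∀ i, ∑ j, (B j * D j i - D j i * B j - ∑ k, (c j i k : ℂ) • D j k) = 0 := by
    intro i
    have : ∀ j, B j * D j i - D j i * B j - ∑ k, (c j i k : ℂ) • D j k =
        (B j * (B j)ᴴ - (B j)ᴴ * B j) * B i - B i * (B j * (B j)ᴴ - (B j)ᴴ * B j) := by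
      intro j
      rw [hDD]
      simp only [D]
      noncomm_ring
    simp only [this]
    rw [Finset.sum_sub_distrib, ← Finset.sum_mul, ← Finset.mul_sum, hM, zero_mul, mul_zero,
      sub_zero]
  have htr : ∑ j, ∑ i, trace (D j i * (D j i)ᴴ) = 0 := by
    have h1 : ∀ j i, trace (D j i * (D j i)ᴴ) = trace ((B j * D j i - D j i * B j) * (B i)ᴴ) +
        ∑ k, (c j i k : ℂ) * trace (D j i * (B k)ᴴ) := by
      intro j i
      conv_lhs => rw [hD j i, conjTranspose_add, mul_add, trace_add, ← hD j i]
      congr 1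
      · rw [← trace_mul_commutator (D j i), conjTranspose_sub, conjTranspose_mul, conjTranspose_mul,
          conjTranspose_conjTranspose]
      · rw [conjTranspose_sum, Finset.mul_sum, trace_sum]
        refine Finset.sum_congr rfl fun k _ => ?_
        rw [conjTranspose_smul, mul_smul_comm, trace_smul, smul_eq_mul]
        simp
    have h2 : ∀ j, ∑ i, trace (D j i * (D j i)ᴴ) = ∑ i, trace
        ((B j * D j i - D j i * B j - ∑ k, (c j i k : ℂ) • D j k) * (B i)ᴴ) := by
      intro j
      have h3 : ∀ i, trace ((B j * D j i - D j i * B j - ∑ k, (c j i k : ℂ) • D j k) * (B i)ᴴ) =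
          trace ((B j * D j i - D j i * B j) * (B i)ᴴ) -
            trace ((∑ k, (c j i k : ℂ) • D j k) * (B i)ᴴ) := fun i => by rw [sub_mul, trace_sub]
      simp only [h1, h3, Finset.sum_add_distrib, Finset.sum_sub_distrib]
      rw [sub_eq_add_neg]
      congr 1
      rw [Finset.sum_comm, ← Finset.sum_neg_distrib]
      refine Finset.sum_congr rfl fun k _ => ?_
      rw [Finset.sum_mul, trace_sum, ← Finset.sum_neg_distrib]
      refine Finset.sum_congr rfl fun i _ => ?_
      rw [smul_mul_assoc, trace_smul, smul_eq_mul, hc.swap_right j k i]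
      push_cast
      ring
    simp only [h2]
    rw [Finset.sum_comm]
    refine Finset.sum_eq_zero fun i _ => ?_
    rw [← trace_sum, ← Finset.sum_mul, hND, zero_mul, trace_zero]
  have hnorm : ∑ j, ∑ i, ‖D j i‖ ^ 2 = 0 := by
    simp only [frobenius_norm_sq, ← Complex.re_sum, htr, Complex.zero_re]
  have h3 := (Finset.sum_eq_zero_iff_of_nonneg (fun j _ => Finset.sum_nonneg
    fun i _ => by positivity)).1 hnorm j (Finset.mem_univ j)
  have h4 := (Finset.sum_eq_zero_iff_of_nonneg (fun i _ => by positivity)).1 h3 i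
    (Finset.mem_univ i)
  have h5 : D j i = 0 := by simpa using h4
  exact sub_eq_zero.1 h5

end Minimal

/-! ### Unitarity of irreducible representations -/

section Families

variable {ι : Type*} [Fintype ι] {c : ι → ι → ι → ℝ}

theorem isRep_iff {V : Type*} [AddCommGroup V] [Module ℂ V] {T : ι → Module.End ℂ V} :
    IsRep c T ↔ ∀ a b v, T a (T b v) - T b (T a v) = ∑ d, (c a b d : ℂ) • T d v := by
  simp [IsRep, LinearMap.ext_iff, LinearMap.sum_apply]

variable {V : Type*} [AddCommGroup V] [Module ℂ V] {T : ι → Module.End ℂ V}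

theorem IsRep.trace_eq_zero (hc : IsCompactSemisimple c) (hT : IsRep c T) (a : ι) :
    LinearMap.trace ℂ V (T a) = 0 := by
  refine congr_fun (hc.eq_zero_of_forall (fun a => LinearMap.trace ℂ V (T a)) fun a b => ?_) a
  have := congr_arg (LinearMap.trace ℂ V) (hT a b)
  rw [map_sub, LinearMap.trace_mul_comm, sub_self, map_sum] at this
  simpa using this.symm

theorem IsRep.restrict (hT : IsRep c T) {W : Submodule ℂ V} (hW : ∀ a, ∀ w ∈ W, T a w ∈ W) :
    IsRep c fun a => (T a).restrict (hW a) := by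
  rw [isRep_iff] at hT ⊢
  intro a b v
  ext
  simpa using hT a b v

theorem IsRep.mapQ (hT : IsRep c T) {W : Submodule ℂ V} (hW : ∀ a, W ≤ W.comap (T a)) :
    IsRep c fun a => W.mapQ W (T a) (hW a) := by
  rw [isRep_iff] at hT ⊢
  intro a b v
  obtain ⟨v, rfl⟩ := W.mkQ_surjective v
  simp only [Submodule.mkQ_apply, Submodule.mapQ_apply, ← Submodule.Quotient.mk_sub, hT]
  simp only [← Submodule.mkQ_apply, map_sum, map_smul]

theorem IsRep.conj {V' : Type*} [AddCommGroup V'] [Module ℂ V'] (hT : IsRep c T) (e : V ≃ₗ[ℂ] V') :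
    IsRep c fun a => e.conj (T a) := by
  rw [isRep_iff] at hT ⊢
  intro a b v
  simp only [LinearEquiv.conj_apply, LinearMap.comp_apply, LinearEquiv.coe_coe,
    LinearEquiv.symm_apply_apply, ← map_sub, hT, map_sum, map_smul]

omit [Fintype ι] in
theorem IsIrreducibleFamily.conj {V' : Type*} [AddCommGroup V'] [Module ℂ V']
    (hT : IsIrreducibleFamily T) (e : V ≃ₗ[ℂ] V') :
    IsIrreducibleFamily fun a => e.conj (T a) := by
  refine ⟨have := hT.1; e.symm.toEquiv.nontrivial, fun W hW => ?_⟩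
  have h := hT.2 (W.comap e.toLinearMap) fun a w hw => by
    simpa using hW a (e w) hw
  rcases h with h | h
  · left
    rw [eq_bot_iff]
    intro w hw
    have : e.symm w ∈ W.comap e.toLinearMap := by simpa using hw
    rw [h, Submodule.mem_bot] at this
    simpa using this
  · right
    rw [eq_top_iff]
    intro w _
    have : e.symm w ∈ W.comap e.toLinearMap := h ▸ Submodule.mem_top
    simpa using this

/-- The pullback of the standard Hermitian inner product of `ℂⁿ` under a linear map. -/
noncomputable def pullbackInner {n : Type*} [Fintype n] (L : V →ₗ[ℂ] (n → ℂ)) :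
    V →ₗ⋆[ℂ] V →ₗ[ℂ] ℂ :=
  LinearMap.mk₂'ₛₗ (starRingEnd ℂ) (RingHom.id ℂ) (fun x y => star (L x) ⬝ᵥ L y)
    (fun x x' y => by simp [add_dotProduct]) (fun r x y => by simp [smul_dotProduct])
    (fun x y y' => by simp [dotProduct_add]) (fun r x y => by simp [dotProduct_smul])

theorem isInner_pullbackInner {n : Type*} [Fintype n] {L : V →ₗ[ℂ] (n → ℂ)}
    (hL : Function.Injective L) : IsInner (pullbackInner L) := by
  refine ⟨fun x y => ?_, fun x hx => ?_⟩
  · change star (star (L x) ⬝ᵥ L y) = star (L y) ⬝ᵥ L x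
    simp [dotProduct, mul_comm]
  · have h : L x ≠ 0 := fun h => hx (hL (by rw [h, map_zero]))
    have hre : star (L x) ⬝ᵥ L x = ((∑ i, ‖L x i‖ ^ 2 : ℝ) : ℂ) := by
      push_cast
      exact Finset.sum_congr rfl fun i _ => RCLike.conj_mul (L x i)
    change 0 < (star (L x) ⬝ᵥ L x).re
    rw [hre, Complex.ofReal_re]
    obtain ⟨i, hi⟩ := Function.ne_iff.1 h
    exact Finset.sum_pos' (fun i _ => by positivity)
      ⟨i, Finset.mem_univ i, pow_pos (norm_pos_iff.2 hi) 2⟩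

/-- An irreducible representation of a compact semisimple Lie algebra is unitary. -/
theorem IsRep.exists_inner_of_irreducible [FiniteDimensional ℂ V] (hc : IsCompactSemisimple c)
    (hT : IsRep c T) (hirr : IsIrreducibleFamily T) :
    ∃ h : V →ₗ⋆[ℂ] V →ₗ[ℂ] ℂ, IsInner h ∧ ∀ a x y, h (T a x) y = -h x (T a y) := by
  let e : V ≃ₗ[ℂ] (Fin (Module.finrank ℂ V) → ℂ) := (Module.finBasis ℂ V).equivFun
  have hrep := hT.conj e
  have hirr' := hirr.conj e
  let A := fun a => LinearMap.toMatrix' (e.conj (T a))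
  have hA : ∀ a, (A a).toLin' = e.conj (T a) := fun a => Matrix.toLin'_toMatrix' _
  obtain ⟨g, B, hg, hgB, hmin⟩ := exists_minimal_conjugate (A := A) (by simpa only [hA] using hirr')
  have hdet := (Matrix.isUnit_iff_isUnit_det g).1 hg
  have hB : ∀ a, B a = g * A a * g⁻¹ := fun a => by
    rw [hgB, mul_assoc, Matrix.mul_nonsing_inv _ hdet, mul_one]
  have hAcomm : IsRep c A := by
    intro a b
    apply Matrix.toLin'.injective
    simp only [map_sub, Matrix.toLin'_mul, map_sum, map_smul, hA]
    exact hrep a b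
  have hBcomm : IsRep c B := by
    intro a b
    have h : ∀ X Y, g * X * g⁻¹ * (g * Y * g⁻¹) = g * (X * Y) * g⁻¹ := fun X Y => by
      rw [mul_assoc (g * X), ← mul_assoc g⁻¹, ← mul_assoc g⁻¹, Matrix.nonsing_inv_mul _ hdet,
        one_mul]
      simp only [mul_assoc]
    simp only [hB, h, ← sub_mul, ← mul_sub, hAcomm a b, Finset.mul_sum, Finset.sum_mul,
      mul_smul_comm, smul_mul_assoc]
  have hcomm := commute_add_conjTranspose hc hBcomm (sum_commutator_conjTranspose_eq_zero hmin)
  have hskew : ∀ j, (B j).conjTranspose = -B j := by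
    intro j
    obtain ⟨z, hz⟩ := hirr'.exists_eq_smul_one (S := (g⁻¹ * ((B j).conjTranspose + B j) * g).toLin')
      fun a => by
        rw [← hA a, Module.End.mul_eq_comp, Module.End.mul_eq_comp, ← Matrix.toLin'_mul,
          ← Matrix.toLin'_mul]
        congr 1
        rw [mul_assoc, hgB, ← mul_assoc, mul_assoc g⁻¹, hcomm, hB]
        simp only [mul_assoc]
        rw [Matrix.nonsing_inv_mul_cancel_left _ _ hdet]
    have hz' : g⁻¹ * ((B j).conjTranspose + B j) * g = z • 1 := by
      apply Matrix.toLin'.injective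
      rw [hz, map_smul, Matrix.toLin'_one]; rfl
    have hS : (B j).conjTranspose + B j = z • 1 := by
      have := congr_arg (fun X => g * X * g⁻¹) hz'
      simp only [mul_smul_comm, smul_mul_assoc, mul_one, Matrix.mul_nonsing_inv _ hdet] at this
      rw [← this, mul_assoc (g⁻¹), Matrix.mul_nonsing_inv_cancel_left _ _ hdet, mul_assoc,
        Matrix.mul_nonsing_inv _ hdet, mul_one]
    have htr : (B j).trace = 0 := by
      refine congr_fun (hc.eq_zero_of_forall (fun a => (B a).trace) fun a b => ?_) j
      have := congr_arg Matrix.trace (hBcomm a b)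
      rw [Matrix.trace_sub, Matrix.trace_mul_comm, sub_self, Matrix.trace_sum] at this
      simpa using this.symm
    have hz0 := congr_arg Matrix.trace hS
    rw [Matrix.trace_add, Matrix.trace_conjTranspose, htr, star_zero, add_zero, Matrix.trace_smul,
      Matrix.trace_one, Fintype.card_fin, smul_eq_mul, eq_comm, mul_eq_zero] at hz0
    have := hirr.1
    have hn : ((Module.finrank ℂ V : ℕ) : ℂ) ≠ 0 := by
      exact_mod_cast (Module.finrank_pos (R := ℂ) (M := V)).ne'
    rw [hz0.resolve_right hn, zero_smul] at hS
    exact eq_neg_of_add_eq_zero_left hS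
  let L : V →ₗ[ℂ] (Fin (Module.finrank ℂ V) → ℂ) := g.toLin' ∘ₗ e.toLinearMap
  have hL : Function.Injective L := (Matrix.mulVec_injective_iff_isUnit.2 hg).comp e.injective
  have hLT : ∀ a x, L (T a x) = (B a).mulVec (L x) := by
    intro a x
    have h1 : e (T a x) = (A a).mulVec (e x) := by
      rw [← Matrix.toLin'_apply, hA]; simp [LinearEquiv.conj_apply]
    simp only [L, LinearMap.comp_apply, LinearEquiv.coe_coe, Matrix.toLin'_apply, h1,
      Matrix.mulVec_mulVec, hgB]
  refine ⟨pullbackInner L, isInner_pullbackInner hL, fun a x y => ?_⟩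
  change star (L (T a x)) ⬝ᵥ L y = -(star (L x) ⬝ᵥ L (T a y))
  rw [hLT, hLT, Matrix.star_mulVec, ← Matrix.dotProduct_mulVec, hskew, Matrix.neg_mulVec,
    dotProduct_neg]

/-! ### Vanishing of the first cohomology and complete reducibility -/

/-- The Casimir operator commutes with the representation. -/
theorem IsRep.casimir_comm (hc : IsCompactSemisimple c) (hT : IsRep c T) (b : ι) :
    (∑ a, T a * T a) * T b = T b * ∑ a, T a * T a := by
  rw [← sub_eq_zero, Finset.sum_mul, Finset.mul_sum, ← Finset.sum_sub_distrib]
  have h : ∀ a, T a * T a * T b - T b * (T a * T a) =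
      ∑ d, (c a b d : ℂ) • (T a * T d) + ∑ d, (c a b d : ℂ) • (T d * T a) := by
    intro a
    simp only [← mul_smul_comm, ← Finset.mul_sum, ← smul_mul_assoc _ (T _) (T a)]
    rw [← Finset.sum_mul, ← hT a b]
    noncomm_ring
  simp only [h]
  rw [Finset.sum_add_distrib]
  conv_lhs => enter [2]; rw [Finset.sum_comm]
  rw [← Finset.sum_add_distrib]
  refine Finset.sum_eq_zero fun a _ => ?_
  rw [← Finset.sum_add_distrib]
  refine Finset.sum_eq_zero fun d _ => ?_
  have : c d b a = -c a b d := by rw [hc.swap_right, hc.swap_left, hc.swap_right]; ring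
  rw [this]; push_cast
  rw [neg_smul, add_neg_cancel]

/-- Vanishing of the first cohomology with coefficients in an irreducible representation: the
Casimir operator is a scalar, which is nonzero unless the representation is trivial. -/
theorem IsRep.exists_eq_apply_of_irreducible [FiniteDimensional ℂ V] (hc : IsCompactSemisimple c)
    (hT : IsRep c T) (hirr : IsIrreducibleFamily T) (f : ι → V)
    (hf : ∀ a b, T a (f b) - T b (f a) = ∑ d, (c a b d : ℂ) • f d) :
    ∃ m, ∀ a, f a = T a m := by
  obtain ⟨h, hh, hskew⟩ := hT.exists_inner_of_irreducible hc hirr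
  obtain ⟨z, hz⟩ := hirr.exists_eq_smul_one fun b => hT.casimir_comm hc b
  by_cases hz0 : z = 0
  -- a zero Casimir operator forces the representation to be trivial, and then `f` vanishes
  · have hT0 : ∀ a x, T a x = 0 := by
      intro a x
      have h1 : ∑ a, h (T a x) (T a x) = 0 := by
        have : h x ((∑ a, T a * T a) x) = 0 := by rw [hz, hz0]; simp
        rw [LinearMap.sum_apply, map_sum] at this
        simpa [hskew] using this
      have h2 : ∀ y, 0 ≤ (h y y).re := fun y => by
        by_cases hy : y = 0
        · simp [hy]
        · exact (hh.pos y hy).le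
      have h3 := congr_arg Complex.re h1
      rw [Complex.re_sum, Complex.zero_re, Finset.sum_eq_zero_iff_of_nonneg fun a _ => h2 _] at h3
      by_contra hne
      exact (hh.pos _ hne).ne' (h3 a (Finset.mem_univ a))
    refine ⟨0, fun a => ?_⟩
    rw [map_zero, ← (Module.finBasis ℂ V).forall_coord_eq_zero_iff]
    intro i
    refine congr_fun (hc.eq_zero_of_forall (fun a => (Module.finBasis ℂ V).coord i (f a))
      fun a b => ?_) a
    have := congr_arg ((Module.finBasis ℂ V).coord i) (hf a b)
    rw [hT0, hT0, sub_zero, map_zero, map_sum] at this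
    simpa using this.symm
  · refine ⟨z⁻¹ • ∑ a, T a (f a), fun b => ?_⟩
    rw [map_smul, eq_inv_smul_iff₀ hz0, map_sum]
    have h1 : z • f b = ∑ a, T a (T a (f b)) := by
      have := LinearMap.congr_fun hz (f b)
      simpa using this.symm
    rw [h1, eq_comm, ← sub_eq_zero, ← Finset.sum_sub_distrib]
    have h2 : ∀ a, T b (T a (f a)) - T a (T a (f b)) =
        ∑ d, (c b a d : ℂ) • T d (f a) + ∑ d, (c b a d : ℂ) • T a (f d) := by
      intro a
      rw [← isRep_iff.1 hT b a (f a)]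
      simp only [← map_smul, ← map_sum]
      rw [← hf b a, map_sub]
      abel
    simp only [h2]
    rw [Finset.sum_add_distrib]
    conv_lhs => enter [2]; rw [Finset.sum_comm]
    rw [← Finset.sum_add_distrib]
    refine Finset.sum_eq_zero fun a _ => ?_
    rw [← Finset.sum_add_distrib]
    refine Finset.sum_eq_zero fun d _ => ?_
    rw [hc.swap_right b a d]; push_cast
    rw [neg_smul, add_neg_cancel]

omit [Fintype ι] in
theorem exists_invariant_of_not_irreducible [Nontrivial V] (h : ¬IsIrreducibleFamily T) :
    ∃ W : Submodule ℂ V, (∀ a, ∀ w ∈ W, T a w ∈ W) ∧ W ≠ ⊥ ∧ W ≠ ⊤ := by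
  by_contra! h'
  refine h ⟨inferInstance, fun W hW => ?_⟩
  by_cases hb : W = ⊥
  · exact Or.inl hb
  · exact Or.inr (h' W hW hb)

end Families

section Cohomology

variable {ι : Type*} [Fintype ι] {c : ι → ι → ι → ℝ}

/-- Whitehead's lemma: the first cohomology of a compact semisimple Lie algebra vanishes. -/
theorem IsRep.exists_eq_apply_of_cocycle (hc : IsCompactSemisimple c) (N : ℕ) :
    ∀ {V : Type u} [AddCommGroup V] [Module ℂ V] [FiniteDimensional ℂ V]
      {T : ι → Module.End ℂ V}, IsRep c T → ∀ f : ι → V, Module.finrank ℂ V ≤ N →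
      (∀ a b, T a (f b) - T b (f a) = ∑ d, (c a b d : ℂ) • f d) → ∃ m, ∀ a, f a = T a m := by
  induction N with
  | zero =>
    intro V _ _ _ T _ f hV _
    have := Module.finrank_zero_iff.1 (Nat.le_zero.1 hV)
    exact ⟨0, fun a => Subsingleton.elim _ _⟩
  | succ N ih =>
    intro V _ _ _ T hT f hV hf
    rcases subsingleton_or_nontrivial V with hs | hn
    · exact ⟨0, fun a => Subsingleton.elim _ _⟩
    by_cases hirr : IsIrreducibleFamily T
    · exact hT.exists_eq_apply_of_irreducible hc hirr f hf
    obtain ⟨W, hW, hb, ht⟩ := exists_invariant_of_not_irreducible hirr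
    have h1 : Module.finrank ℂ (V ⧸ W) ≤ N := by
      have := W.finrank_quotient_add_finrank
      have := Submodule.one_le_finrank_iff.2 hb
      omega
    have h2 : Module.finrank ℂ W ≤ N := by
      have := Submodule.finrank_lt ht
      omega
    -- first modulo `W`, then the remainder takes values in `W`
    obtain ⟨m, hm⟩ := ih (hT.mapQ hW) (fun a => W.mkQ (f a)) h1 fun a b => by
      have := congr_arg W.mkQ (hf a b)
      rw [map_sub, map_sum] at this
      simpa using this
    obtain ⟨m, rfl⟩ := W.mkQ_surjective m
    have hmem : ∀ a, f a - T a m ∈ W := by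
      intro a
      have := hm a
      rw [Submodule.mkQ_apply, Submodule.mkQ_apply, Submodule.mapQ_apply] at this
      exact (Submodule.Quotient.eq W).1 this
    obtain ⟨m', hm'⟩ := ih (hT.restrict hW) (fun a => ⟨f a - T a m, hmem a⟩) h2 fun a b => by
      ext
      have := isRep_iff.1 hT a b m
      simp only [LinearMap.restrict_apply, map_sub, AddSubgroupClass.coe_sub,
        AddSubmonoidClass.coe_finsetSum, Submodule.coe_smul, smul_sub, Finset.sum_sub_distrib,
        ← hf, ← this]
      abel
    refine ⟨m + m', fun a => ?_⟩
    have := congr_arg Subtype.val (hm' a)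
    simp only [LinearMap.restrict_apply] at this
    rw [map_add, ← this]
    abel

/-- Complete reducibility. -/
theorem IsRep.exists_isCompl (hc : IsCompactSemisimple c) {V : Type u} [AddCommGroup V]
    [Module ℂ V] [FiniteDimensional ℂ V] {T : ι → Module.End ℂ V} (hT : IsRep c T)
    {W : Submodule ℂ V} (hW : ∀ a, ∀ w ∈ W, T a w ∈ W) :
    ∃ W' : Submodule ℂ V, IsCompl W W' ∧ ∀ a, ∀ w ∈ W', T a w ∈ W' := by
  obtain ⟨q, hq⟩ := W.exists_isCompl
  let π : Module.End ℂ V := W.projection q hq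
  have hπ : ∀ v, π v ∈ W := Submodule.projection_apply_mem hq
  have hπ' : ∀ w ∈ W, π w = w := fun w hw => Submodule.projection_apply_of_mem_left hq hw
  -- the failure of `π` to be equivariant is a cocycle with values in `M`
  let M : Submodule ℂ (Module.End ℂ V) :=
    { carrier := {φ | (∀ v, φ v ∈ W) ∧ ∀ w ∈ W, φ w = 0}
      zero_mem' := by simp
      add_mem' := fun {φ ψ} h1 h2 => ⟨fun v => W.add_mem (h1.1 v) (h2.1 v),
        fun w hw => by simp [h1.2 w hw, h2.2 w hw]⟩
      smul_mem' := fun r φ h => ⟨fun v => W.smul_mem r (h.1 v), fun w hw => by simp [h.2 w hw]⟩ }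
  let ad : ι → Module.End ℂ (Module.End ℂ V) := fun a =>
    LinearMap.mulLeft ℂ (T a) - LinearMap.mulRight ℂ (T a)
  have had : ∀ a φ, ad a φ = T a * φ - φ * T a := fun a φ => rfl
  have hadrep : IsRep c ad := by
    rw [isRep_iff]
    intro a b φ
    have h : ad a (ad b φ) - ad b (ad a φ) =
        (T a * T b - T b * T a) * φ - φ * (T a * T b - T b * T a) := by
      simp only [had]; noncomm_ring
    rw [h, hT a b, Finset.sum_mul, Finset.mul_sum, ← Finset.sum_sub_distrib]
    refine Finset.sum_congr rfl fun d _ => ?_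
    rw [had, smul_sub, smul_mul_assoc, mul_smul_comm]
  have hM : ∀ a, ∀ φ ∈ M, ad a φ ∈ M := by
    intro a φ hφ
    refine ⟨fun v => ?_, fun w hw => ?_⟩
    · exact W.sub_mem (hW a _ (hφ.1 v)) (hφ.1 _)
    · simp [had, hφ.2 w hw, hφ.2 _ (hW a w hw)]
  have hfM : ∀ a, ad a π ∈ M := by
    intro a
    refine ⟨fun v => W.sub_mem (hW a _ (hπ v)) (hπ _), fun w hw => ?_⟩
    simp [had, hπ' w hw, hπ' _ (hW a w hw)]
  obtain ⟨m, hm⟩ := IsRep.exists_eq_apply_of_cocycle hc _ (hadrep.restrict hM)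
    (fun a => ⟨ad a π, hfM a⟩) le_rfl fun a b => by
      ext1
      simpa [AddSubmonoidClass.coe_finsetSum] using isRep_iff.1 hadrep a b π
  have hcomm : ∀ a v, T a ((π - m.1) v) = (π - m.1) (T a v) := by
    intro a v
    have h := congr_arg Subtype.val (hm a)
    have h' := LinearMap.congr_fun h v
    simp only [LinearMap.restrict_apply, had, LinearMap.sub_apply, Module.End.mul_apply] at h'
    simp only [LinearMap.sub_apply, map_sub]
    rw [sub_eq_sub_iff_add_eq_add] at h' ⊢
    rw [h', add_comm]
  let P : V →ₗ[ℂ] W := (π - m.1).codRestrict W fun v => W.sub_mem (hπ v) (m.2.1 v)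
  refine ⟨LinearMap.ker P, LinearMap.isCompl_of_proj fun x => ?_, fun a w hw => ?_⟩
  · ext
    simp [P, hπ' x x.2, m.2.2 x x.2]
  · rw [LinearMap.mem_ker] at hw ⊢
    ext
    have hw' := congr_arg Subtype.val hw
    simp only [P, LinearMap.codRestrict_apply, ZeroMemClass.coe_zero] at hw' ⊢
    rw [← hcomm, hw', map_zero]

/-- Every finite-dimensional representation of a compact semisimple Lie algebra is unitary. -/
theorem IsRep.exists_inner (hc : IsCompactSemisimple c) (N : ℕ) :
    ∀ {V : Type u} [AddCommGroup V] [Module ℂ V] [FiniteDimensional ℂ V]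
      {T : ι → Module.End ℂ V}, IsRep c T → Module.finrank ℂ V ≤ N →
      ∃ h : V →ₗ⋆[ℂ] V →ₗ[ℂ] ℂ, IsInner h ∧ ∀ a x y, h (T a x) y = -h x (T a y) := by
  induction N with
  | zero =>
    intro V _ _ _ T _ hV
    have := Module.finrank_zero_iff.1 (Nat.le_zero.1 hV)
    exact ⟨0, ⟨by simp, fun x hx => absurd (Subsingleton.elim x 0) hx⟩, by simp⟩
  | succ N ih =>
    intro V _ _ _ T hT hV
    rcases subsingleton_or_nontrivial V with hs | hn
    · exact ⟨0, ⟨by simp, fun x hx => absurd (Subsingleton.elim x 0) hx⟩, by simp⟩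
    by_cases hirr : IsIrreducibleFamily T
    · exact hT.exists_inner_of_irreducible hc hirr
    obtain ⟨W, hW, hb, ht⟩ := exists_invariant_of_not_irreducible hirr
    obtain ⟨W', hc', hW'⟩ := hT.exists_isCompl hc hW
    have hd := Submodule.finrank_add_eq_of_isCompl hc'
    have h1 : Module.finrank ℂ W' ≤ N := by
      have := Submodule.one_le_finrank_iff.2 hb
      omega
    have h2 : Module.finrank ℂ W ≤ N := by
      have := Submodule.finrank_lt ht
      omega
    obtain ⟨h, hh, hs⟩ := ih (hT.restrict hW) h2
    obtain ⟨h', hh', hs'⟩ := ih (hT.restrict hW') h1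
    let P := W.projectionOnto W' hc'
    let Q := W'.projectionOnto W hc'.symm
    have hPQ : ∀ x, (P x : V) + Q x = x := fun x =>
      LinearMap.congr_fun (Submodule.projection_add_projection_eq_id hc') x
    have hsplit : ∀ a x, P (T a x) = (T a).restrict (hW a) (P x) ∧
        Q (T a x) = (T a).restrict (hW' a) (Q x) := by
      intro a x
      have hx : T a x = T a (P x) + T a (Q x) := by rw [← map_add, hPQ]
      have h3 := hW a _ (P x).2
      have h4 := hW' a _ (Q x).2
      constructor
      · rw [hx, map_add, Submodule.projectionOnto_apply_of_mem_left hc' h3,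
          (Submodule.projectionOnto_apply_eq_zero_iff hc').2 h4, add_zero]
        rfl
      · rw [hx, map_add, Submodule.projectionOnto_apply_of_mem_left hc'.symm h4,
          (Submodule.projectionOnto_apply_eq_zero_iff hc'.symm).2 h3, zero_add]
        rfl
    refine ⟨(h.comp P).compl₂ P + (h'.comp Q).compl₂ Q, ⟨fun x y => ?_, fun x hx => ?_⟩,
      fun a x y => ?_⟩
    · simp [hh.conj_symm, hh'.conj_symm]
    · have h0 : ∀ y, 0 ≤ (h y y).re := fun y => by
        by_cases hy : y = 0
        · simp [hy]
        · exact (hh.pos y hy).le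
      have h0' : ∀ y, 0 ≤ (h' y y).re := fun y => by
        by_cases hy : y = 0
        · simp [hy]
        · exact (hh'.pos y hy).le
      simp only [LinearMap.add_apply, LinearMap.compl₂_apply, LinearMap.comp_apply, Complex.add_re]
      by_cases hP : P x = 0
      · have hQ : Q x ≠ 0 := fun hQ => hx (by rw [← hPQ x, hP, hQ]; simp)
        exact add_pos_of_nonneg_of_pos (h0 _) (hh'.pos _ hQ)
      · exact add_pos_of_pos_of_nonneg (hh.pos _ hP) (h0' _)
    · simp only [LinearMap.add_apply, LinearMap.compl₂_apply, LinearMap.comp_apply, (hsplit a _).1,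
        (hsplit a _).2, hs, hs']
      ring

end Cohomology

/-! ### Sesquilinear forms relative to an inner product -/

section Inner

variable {V : Type*} [AddCommGroup V] [Module ℂ V] [FiniteDimensional ℂ V]
  {h : V →ₗ⋆[ℂ] V →ₗ[ℂ] ℂ}

/-- The spectral theorem for an operator which is symmetric for a positive definite form. -/
theorem IsInner.exists_eigenbasis (hh : IsInner h) {S : Module.End ℂ V}
    (hS : ∀ x y, h (S x) y = h x (S y)) :
    ∃ (b : Module.Basis (Fin (Module.finrank ℂ V)) ℂ V) (μ : Fin (Module.finrank ℂ V) → ℝ),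
      (∀ i, S (b i) = (μ i : ℂ) • b i) ∧ ∀ i j, h (b i) (b j) = if i = j then 1 else 0 := by
  let core : InnerProductSpace.Core ℂ V :=
    { inner := fun x y => h x y
      conj_inner_symm := fun x y => hh.conj_symm y x
      re_inner_nonneg := fun x => by
        by_cases hx : x = 0
        · simp [hx]
        · exact (hh.pos x hx).le
      add_left := fun x y z => by simp
      smul_left := fun x y r => by simp
      definite := fun x hx => by
        by_contra hne
        have := hh.pos x hne
        rw [hx] at this
        simp at this }
  let : NormedAddCommGroup V := core.toNormedAddCommGroup
  let : InnerProductSpace ℂ V := InnerProductSpace.ofCore core.toCore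
  have hinner : ∀ x y : V, inner ℂ x y = h x y := fun x y => rfl
  have hsym : S.IsSymmetric := fun x y => by rw [hinner, hinner, hS]
  let b := hsym.eigenvectorBasis rfl
  refine ⟨b.toBasis, hsym.eigenvalues rfl, fun i => ?_, fun i j => ?_⟩
  · rw [OrthonormalBasis.coe_toBasis]
    exact hsym.apply_eigenvectorBasis rfl i
  · rw [OrthonormalBasis.coe_toBasis, ← hinner]
    exact orthonormal_iff_ite.1 b.orthonormal i j

omit [FiniteDimensional ℂ V] in
theorem IsInner.ext (hh : IsInner h) {x y : V} (hxy : ∀ z, h x z = h y z) : x = y := by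
  by_contra hne
  have := hh.pos _ (sub_ne_zero.2 hne)
  rw [map_sub h, LinearMap.sub_apply, hxy, sub_self] at this
  simp at this

/-- Every linear functional is represented by a vector with respect to an inner product. -/
theorem IsInner.exists_riesz (hh : IsInner h) (φ : V →ₗ[ℂ] ℂ) : ∃ x, ∀ v, φ v = h x v := by
  obtain ⟨b, -, -, hb⟩ := hh.exists_eigenbasis (S := 0) (by simp)
  refine ⟨∑ i, conj (φ (b i)) • b i, fun v => ?_⟩
  have : φ = h (∑ i, conj (φ (b i)) • b i) := by
    refine b.ext fun j => ?_
    simp [LinearMap.sum_apply, hb]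
  rw [← this]

/-- Every sesquilinear form is represented by an operator with respect to an inner product. -/
theorem IsInner.exists_represents (hh : IsInner h) (F : V →ₗ⋆[ℂ] V →ₗ[ℂ] ℂ) :
    ∃ A : Module.End ℂ V, ∀ u v, F u v = h (A u) v := by
  choose A hA using fun u => hh.exists_riesz (F u)
  exact ⟨{ toFun := A
           map_add' := fun u u' => hh.ext fun v => by simp [← hA]
           map_smul' := fun r u => hh.ext fun v => by simp [← hA] }, hA⟩

variable (V) in
theorem exists_isInner : ∃ h : V →ₗ⋆[ℂ] V →ₗ[ℂ] ℂ, IsInner h :=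
  ⟨_, isInner_pullbackInner (L := ((Module.finBasis ℂ V).equivFun).toLinearMap)
    (LinearEquiv.injective _)⟩

theorem exists_form_eq_of_separatingLeft {F : V →ₗ⋆[ℂ] V →ₗ[ℂ] ℂ} (hF : F.SeparatingLeft)
    (φ : V →ₗ[ℂ] ℂ) : ∃ w, ∀ v, F w v = φ v := by
  obtain ⟨h, hh⟩ := exists_isInner V
  obtain ⟨A, hA⟩ := hh.exists_represents F
  obtain ⟨x, hx⟩ := hh.exists_riesz φ
  have hAinj : Function.Injective A := (injective_iff_map_eq_zero A).2 fun w hw =>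
    hF w fun v => by rw [hA, hw]; simp
  obtain ⟨w, rfl⟩ := LinearMap.injective_iff_surjective.1 hAinj x
  exact ⟨w, fun v => by rw [hA, hx]⟩

/-- Functional calculus for an endomorphism: `φ(N)`, as a polynomial in `N`. -/
theorem exists_functionalCalculus (N : Module.End ℂ V) (φ : ℂ → ℂ) :
    ∃ τ : Module.End ℂ V, (∀ z u, N u = z • u → τ u = φ z • u) ∧
      ∀ W : Submodule ℂ V, (∀ w ∈ W, N w ∈ W) → ∀ w ∈ W, τ w ∈ W := by
  let s : Finset ℂ := (Module.End.finite_hasEigenvalue N).toFinset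
  let q := Lagrange.interpolate s id φ
  refine ⟨Polynomial.aeval N q, fun z u hu => ?_, fun W hW w hw => ?_⟩
  · by_cases hu0 : u = 0
    · simp [hu0]
    have hv : N.HasEigenvector z u := ⟨Module.End.mem_eigenspace_iff.2 hu, hu0⟩
    rw [Module.End.aeval_apply_of_hasEigenvector hv]
    congr 1
    have hz : z ∈ s := by
      simpa [s] using Module.End.hasEigenvalue_of_hasEigenvector hv
    exact Lagrange.eval_interpolate_at_node φ Function.injective_id.injOn hz
  · induction q using Polynomial.induction_on' with
    | add p q hp hq => rw [map_add, LinearMap.add_apply]; exact W.add_mem hp hq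
    | monomial k r =>
      rw [Polynomial.aeval_monomial, Module.End.mul_apply, Module.algebraMap_end_apply]
      refine W.smul_mem r ?_
      induction k with
      | zero => simpa using hw
      | succ k ih => rw [pow_succ', Module.End.mul_apply]; exact hW _ ih

end Inner

/-! ### Compact frames of a real Lie algebra of Hermitian type -/

/-- A basis-like family `X` of a real Lie algebra adapted to a Cartan decomposition `𝔨 + 𝔭`
(`s a = 1` for members of `𝔨` and `s a = i` for members of `𝔭`), such that the elements
`s a • X a` of the complexification satisfy the relations of a compact semisimple Lie algebra,
together with an element `Z` of `𝔨` inducing a complex structure on `𝔭`. -/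
structure CompactFrame (L : Type*) [LieRing L] [LieAlgebra ℝ L] where
  /-- the number of elements -/
  n : ℕ
  /-- the elements -/
  X : Fin n → L
  /-- the factors which turn the elements into elements of the compact dual -/
  s : Fin n → ℂ
  /-- the structure constants -/
  e : Fin n → Fin n → Fin n → ℝ
  /-- the structure constants of the compact dual -/
  c : Fin n → Fin n → Fin n → ℝ
  /-- the element inducing the complex structure -/
  Z : L
  span_eq_top : Submodule.span ℝ (Set.range X) = ⊤
  lie_eq : ∀ a b, ⁅X a, X b⁆ = ∑ d, e a b d • X d
  scale : ∀ a b d, s a * s b * e a b d = c a b d * s d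
  compact : IsCompactSemisimple c
  lie_Z : ∀ a, (s a = 1 ∧ ⁅Z, X a⁆ = 0) ∨ (s a = Complex.I ∧ ⁅Z, ⁅Z, X a⁆⁆ = -X a)
  Z_mem : Z ∈ Submodule.span ℝ (X '' {a | s a = 1})

section Representation

variable {L : Type*} [LieRing L] [LieAlgebra ℝ L] {V : Type*} [AddCommGroup V] [Module ℂ V]

/-- The real scalar multiplication on endomorphisms is the restriction of the complex one. -/
theorem real_smul_end (r : ℝ) (T : Module.End ℂ V) : r • T = (r : ℂ) • T := by
  ext; simp

/-- The representation of the compact dual obtained from a representation. -/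
theorem CompactFrame.isRep (D : CompactFrame L) (ρ : L →ₗ⁅ℝ⁆ Module.End ℂ V) :
    IsRep D.c fun a => D.s a • ρ (D.X a) := by
  intro a b
  have h1 : ρ (D.X a) * ρ (D.X b) - ρ (D.X b) * ρ (D.X a) =
      ∑ d, (D.e a b d : ℂ) • ρ (D.X d) := by
    rw [← Ring.lie_def, ← LieHom.map_lie, D.lie_eq, map_sum]
    exact Finset.sum_congr rfl fun d _ => by rw [map_smul, real_smul_end]
  have h2 : ∀ x y : ℂ, ∀ P Q : Module.End ℂ V,
      x • P * y • Q - y • Q * x • P = (x * y) • (P * Q - Q * P) := by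
    intro x y P Q
    simp only [smul_mul_assoc, mul_smul_comm, smul_smul, smul_sub, mul_comm y x]
  rw [h2, h1, Finset.smul_sum]
  exact Finset.sum_congr rfl fun d _ => by rw [smul_smul, smul_smul, D.scale]

theorem CompactFrame.s_ne_zero (D : CompactFrame L) (a : Fin D.n) : D.s a ≠ 0 := by
  rcases D.lie_Z a with ⟨h, -⟩ | ⟨h, -⟩ <;> simp [h]

theorem CompactFrame.induction (D : CompactFrame L) {p : L → Prop} (h : ∀ a, p (D.X a))
    (h0 : p 0) (hadd : ∀ x y, p x → p y → p (x + y)) (hsmul : ∀ (r : ℝ) x, p x → p (r • x))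
    (x : L) : p x := by
  have hx : x ∈ Submodule.span ℝ (Set.range D.X) := D.span_eq_top ▸ Submodule.mem_top
  induction hx using Submodule.span_induction with
  | mem x hx => obtain ⟨a, rfl⟩ := hx; exact h a
  | zero => exact h0
  | add x y _ _ hx hy => exact hadd x y hx hy
  | smul r x _ hx => exact hsmul r x hx

theorem CompactFrame.trace_eq_zero (D : CompactFrame L) (ρ : L →ₗ⁅ℝ⁆ Module.End ℂ V) (x : L) :
    LinearMap.trace ℂ V (ρ x) = 0 := by
  refine D.induction (p := fun x => LinearMap.trace ℂ V (ρ x) = 0) (fun a => ?_) (by simp)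
    (fun x y hx hy => by rw [map_add, map_add, hx, hy, add_zero])
    (fun r x hx => by rw [map_smul, real_smul_end, map_smul, hx, smul_zero]) x
  have := (D.isRep ρ).trace_eq_zero D.compact a
  rw [map_smul, smul_eq_mul] at this
  exact (mul_eq_zero.1 this).resolve_left (D.s_ne_zero a)

/-- The restriction of a representation to an invariant subspace. -/
noncomputable def restrictRep (ρ : L →ₗ⁅ℝ⁆ Module.End ℂ V) (W : Submodule ℂ V)
    (hW : ∀ x, ∀ w ∈ W, ρ x w ∈ W) : L →ₗ⁅ℝ⁆ Module.End ℂ W where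
  toFun x := (ρ x).restrict (hW x)
  map_add' x y := by ext; simp
  map_smul' r x := by ext; simp
  map_lie' {x y} := by ext; simp [Ring.lie_def]

/-- If `[Z, [Z, X]] = -X` then `φ(Z)` and `X` anticommute (on eigenvectors of `Z`) for every
function `φ` which changes its sign under translation by `±i`. -/
theorem anticomm_of_lie_lie {N K τ : Module.End ℂ V} {φ : ℂ → ℂ}
    (hK : ⁅N, ⁅N, K⁆⁆ = -K) (hτ : ∀ z u, N u = z • u → τ u = φ z • u)
    (hφ : ∀ z, φ (z + Complex.I) = -φ z) {z : ℂ} {u : V} (hu : N u = z • u) :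
    τ (K u) = -K (τ u) := by
  set P := ⁅N, K⁆ with hP
  have h1 : N (K u) = z • K u + P u := by
    rw [hP, Ring.lie_def, LinearMap.sub_apply, Module.End.mul_apply, Module.End.mul_apply, hu,
      map_smul]
    abel
  have h2 : N (P u) = z • P u - K u := by
    have := LinearMap.congr_fun hK u
    rw [Ring.lie_def, LinearMap.sub_apply, Module.End.mul_apply, Module.End.mul_apply, hu,
      map_smul, LinearMap.neg_apply, sub_eq_iff_eq_add] at this
    rw [this]
    abel
  have hII := Complex.I_mul_I
  have h3 := hτ (z + Complex.I) (K u - Complex.I • P u) (by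
    rw [map_sub, map_smul, h1, h2]
    linear_combination (norm := module) hII • P u)
  have h4 := hτ (z - Complex.I) (K u + Complex.I • P u) (by
    rw [map_add, map_smul, h1, h2]
    linear_combination (norm := module) hII • P u)
  have h5 : φ (z - Complex.I) = -φ z := by
    rw [← sub_add_cancel z Complex.I, hφ, neg_neg, add_sub_cancel_right]
  rw [hφ, map_sub, map_smul] at h3
  rw [h5, map_add, map_smul] at h4
  rw [hτ z u hu, map_smul]
  have : (2 : ℂ) • τ (K u) = (2 : ℂ) • -(φ z • K u) := by
    linear_combination (norm := module) h3 + h4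
  exact smul_right_injective V (two_ne_zero' ℂ) this

end Representation

section Nondegenerate

variable {L : Type*} [LieRing L] [LieAlgebra ℝ L] {V : Type u} [AddCommGroup V] [Module ℂ V]
  [FiniteDimensional ℂ V]

/-- A nonzero representation with an invariant nondegenerate sesquilinear form has an irreducible
subrepresentation on which the form is nondegenerate. Relative to a definite form invariant under
the compact dual, `F` is given by an operator `A` which, like `τ = exp (π ρ(Z))`, commutes with
`ρ(𝔨)` and anticommutes with `ρ(𝔭)`. So `τ⁻¹ A` has an invariant eigenspace, and there `A` is a
nonzero multiple of the invertible operator `τ`. -/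
theorem CompactFrame.exists_irreducible_nondegenerate [Nontrivial V] (D : CompactFrame L)
    (ρ : L →ₗ⁅ℝ⁆ Module.End ℂ V) {F : V →ₗ⋆[ℂ] V →ₗ[ℂ] ℂ} (hF : F.SeparatingLeft)
    (hρ : ∀ x u v, F (ρ x u) v + F u (ρ x v) = 0) :
    ∃ W : Submodule ℂ V, W ≠ ⊥ ∧ (∀ x, ∀ w ∈ W, ρ x w ∈ W) ∧
      (∀ W' ≤ W, (∀ x, ∀ w ∈ W', ρ x w ∈ W') → W' = ⊥ ∨ W' = W) ∧
      ∀ w ∈ W, (∀ v ∈ W, F w v = 0) → w = 0 := by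
  obtain ⟨h, hh, hskew⟩ := IsRep.exists_inner D.compact _ (D.isRep ρ) le_rfl
  have hskew1 : ∀ a, D.s a = 1 → ∀ u v, h (ρ (D.X a) u) v = -h u (ρ (D.X a) v) := by
    intro a ha u v
    simpa [ha] using hskew a u v
  have hskewI : ∀ a, D.s a = Complex.I → ∀ u v, h (ρ (D.X a) u) v = h u (ρ (D.X a) v) := by
    intro a ha u v
    simpa [ha] using hskew a u v
  obtain ⟨A, hA⟩ := hh.exists_represents F
  have hA0 : ∀ w, A w = 0 → w = 0 := fun w hw => hF w fun v => by rw [hA, hw]; simp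
  have hAinv : ∀ x u v, h (A (ρ x u)) v = -h (A u) (ρ x v) := fun x u v => by
    rw [← hA, ← hA]; exact eq_neg_of_add_eq_zero_left (hρ x u v)
  -- `ρ(Z)` is skew, hence diagonalizable
  have hZskew : ∀ u v, h (ρ D.Z u) v = -h u (ρ D.Z v) := by
    refine Submodule.span_induction (p := fun x _ => ∀ u v, h (ρ x u) v = -h u (ρ x v))
      ?_ ?_ ?_ ?_ D.Z_mem
    · rintro _ ⟨a, ha, rfl⟩
      exact hskew1 a ha
    · simp
    · intro x y _ _ hx hy u v
      simp [hx, hy]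
      ring
    · intro r x _ hx u v
      rw [map_smul, real_smul_end]
      simp only [LinearMap.smul_apply, map_smulₛₗ, hx]
      simp
  obtain ⟨b, μ, hb, -⟩ := hh.exists_eigenbasis (S := Complex.I • ρ D.Z) fun x y => by
    simp [hZskew]
  have hbZ : ∀ i, ρ D.Z (b i) = (-Complex.I * μ i) • b i := by
    intro i
    rw [mul_smul, ← hb i, LinearMap.smul_apply, smul_smul]
    simp
  -- `τ = exp (π ρ(Z))` and `τ' = exp (-π ρ(Z))` implement the Cartan involution
  obtain ⟨τ, hτ, hτW⟩ := exists_functionalCalculus (ρ D.Z) fun z => Complex.exp (Real.pi * z)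
  obtain ⟨τ', hτ', -⟩ := exists_functionalCalculus (ρ D.Z) fun z => Complex.exp (-(Real.pi * z))
  have hττ' : τ * τ' = 1 := by
    refine b.ext fun i => ?_
    rw [Module.End.mul_apply, hτ' _ _ (hbZ i), map_smul, hτ _ _ (hbZ i), smul_smul,
      ← Complex.exp_add, neg_add_cancel, Complex.exp_zero, one_smul, Module.End.one_apply]
  have hτ'τ : τ' * τ = 1 := mul_eq_one_comm.1 hττ'
  have hcomm : ∀ a u, τ' (A (ρ (D.X a) u)) = ρ (D.X a) (τ' (A u)) := by
    intro a
    rcases D.lie_Z a with ⟨ha, hZ⟩ | ⟨ha, hZ⟩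
    · have hAK : ∀ u, A (ρ (D.X a) u) = ρ (D.X a) (A u) := fun u =>
        hh.ext fun v => by rw [hAinv, hskew1 a ha]
      have hZ' : ∀ u, ρ D.Z (ρ (D.X a) u) = ρ (D.X a) (ρ D.Z u) := fun u => by
        have := LinearMap.congr_fun (congr_arg ρ hZ) u
        rw [LieHom.map_lie, Ring.lie_def, map_zero] at this
        exact sub_eq_zero.1 this
      have hτK : τ' ∘ₗ ρ (D.X a) = ρ (D.X a) ∘ₗ τ' := by
        refine b.ext fun i => ?_
        rw [LinearMap.comp_apply, LinearMap.comp_apply, hτ' _ _ (hbZ i), map_smul]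
        exact hτ' _ _ (by rw [hZ', hbZ, map_smul])
      exact fun u => by rw [hAK]; exact LinearMap.congr_fun hτK (A u)
    · have hAK : ∀ u, A (ρ (D.X a) u) = -ρ (D.X a) (A u) := fun u =>
        hh.ext fun v => by rw [hAinv, map_neg, LinearMap.neg_apply, hskewI a ha]
      have hτK : τ' ∘ₗ ρ (D.X a) = -(ρ (D.X a) ∘ₗ τ') := by
        refine b.ext fun i => ?_
        refine anticomm_of_lie_lie (N := ρ D.Z) ?_ hτ' (fun z => ?_) (hbZ i)
        · rw [← LieHom.map_lie, ← LieHom.map_lie, hZ, map_neg]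
        · rw [mul_add, neg_add, Complex.exp_add, Complex.exp_neg (Real.pi * Complex.I),
            Complex.exp_pi_mul_I]
          norm_num
      intro u
      have := LinearMap.congr_fun hτK (A u)
      rw [hAK, map_neg, neg_eq_iff_eq_neg]
      exact this
  -- by `hcomm`, the eigenspaces of `τ⁻¹ A` are invariant
  obtain ⟨z, hz⟩ := Module.End.exists_eigenvalue (τ' * A)
  let E := (τ' * A).eigenspace z
  have hE : ∀ w ∈ E, A w = z • τ w := by
    intro w hw
    have h1 : τ' (A w) = z • w := Module.End.mem_eigenspace_iff.1 hw
    rw [← map_smul, ← h1]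
    exact (LinearMap.congr_fun hττ' (A w)).symm
  have hEinv : ∀ x, ∀ w ∈ E, ρ x w ∈ E := by
    intro x
    refine D.induction (p := fun x => ∀ w ∈ E, ρ x w ∈ E) (fun a w hw => ?_) (by simp)
      (fun x y hx hy w hw => ?_) (fun r x hx w hw => ?_) x
    · have h1 : τ' (A w) = z • w := Module.End.mem_eigenspace_iff.1 hw
      rw [Module.End.mem_eigenspace_iff, Module.End.mul_apply, hcomm, h1, map_smul]
    · rw [map_add]; exact E.add_mem (hx w hw) (hy w hw)
    · rw [map_smul, real_smul_end]; exact E.smul_mem _ (hx w hw)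
  obtain ⟨W, ⟨hWE, hWb, hWinv⟩, hmin⟩ := (wellFounded_lt (α := Submodule ℂ V)).has_min
    {W | W ≤ E ∧ W ≠ ⊥ ∧ ∀ x, ∀ w ∈ W, ρ x w ∈ W} ⟨E, le_rfl, hz, hEinv⟩
  refine ⟨W, hWb, hWinv, fun W' hW' hinv => ?_, fun w hw hwv => ?_⟩
  · by_contra! hne
    exact hmin W' ⟨hW'.trans hWE, hne.1, hinv⟩ (lt_of_le_of_ne hW' hne.2)
  · by_contra hw0
    have hz0 : z ≠ 0 := by
      rintro rfl
      exact hw0 (hA0 w (by rw [hE w (hWE hw), zero_smul]))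
    have hτw : τ w ≠ 0 := fun h0 => hw0 (by
      have := LinearMap.congr_fun hτ'τ w
      rw [Module.End.mul_apply, h0, map_zero] at this
      exact this.symm)
    -- `τ w` lies in `W` since `τ` is a polynomial in `ρ(Z)`, and `F(w, τ w)` is a nonzero multiple
    -- of the squared length of `τ w`
    have := hwv (τ w) (hτW W (hWinv D.Z) w hw)
    rw [hA, hE w (hWE hw)] at this
    simp only [map_smulₛₗ, LinearMap.smul_apply, smul_eq_mul, mul_eq_zero, map_eq_zero, hz0,
      false_or] at this
    have hpos := hh.pos _ hτw
    rw [this] at hpos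
    simp at hpos

end Nondegenerate

/-! ### Sylvester's law for Hermitian forms -/

theorem stdForm_single (p q : ℕ) (k l : Fin p ⊕ Fin q) :
    stdForm p q (Pi.single k 1) (Pi.single l 1) =
      if k = l then Sum.elim (fun _ => (1 : ℂ)) (fun _ => -1) k else 0 := by
  rcases k with k | k <;> rcases l with l | l <;>
    simp [stdForm, Pi.single_apply, apply_ite, eq_comm (a := k)]

/-- A nondegenerate Hermitian form has a signature. -/
theorem exists_hasSignature {V : Type*} [AddCommGroup V] [Module ℂ V] [FiniteDimensional ℂ V]
    {F : V →ₗ⋆[ℂ] V →ₗ[ℂ] ℂ} (hF : F.IsSymm) (hF' : F.SeparatingLeft) :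
    ∃ r s, HasSignature F r s := by
  obtain ⟨h, hh⟩ := exists_isInner V
  obtain ⟨S, hS⟩ := hh.exists_represents F
  have hsym : ∀ x y, h (S x) y = h x (S y) := by
    intro x y
    rw [← hS, ← hF.eq, hS]
    exact hh.conj_symm _ _
  obtain ⟨b, μ, hb, hbb⟩ := hh.exists_eigenbasis hsym
  have hFb : ∀ i j, F (b i) (b j) = if i = j then (μ i : ℂ) else 0 := by
    intro i j
    rw [hS, hb, map_smulₛₗ, LinearMap.smul_apply, hbb]
    simp
  have hμ : ∀ i, μ i ≠ 0 := by
    intro i hi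
    refine b.ne_zero i (hF' _ fun v => ?_)
    rw [hS, hb, hi]
    simp
  let f : {i // 0 < μ i} ⊕ {i // ¬0 < μ i} ≃ Fin (Fintype.card {i // 0 < μ i}) ⊕
      Fin (Fintype.card {i // ¬0 < μ i}) :=
    Equiv.sumCongr (Fintype.equivFin _) (Fintype.equivFin _)
  let g := (Equiv.sumCompl fun i => 0 < μ i).symm.trans f
  have hne : ∀ i, IsUnit (((√|μ i|)⁻¹ : ℝ) : ℂ) := fun i => by
    rw [isUnit_iff_ne_zero]
    exact_mod_cast inv_ne_zero (Real.sqrt_ne_zero'.2 (abs_pos.2 (hμ i)))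
  let b' := (b.isUnitSMul hne).reindex g
  have hb' : ∀ k, b' k = (((√|μ (g.symm k)|)⁻¹ : ℝ) : ℂ) • b (g.symm k) := fun k => by
    simp [b', Module.Basis.isUnitSMul_apply]
  have hFb' : ∀ k l, F (b' k) (b' l) =
      if k = l then Sum.elim (fun _ => (1 : ℂ)) (fun _ => -1) k else 0 := by
    intro k l
    rw [hb', hb', map_smul, map_smulₛₗ F, LinearMap.smul_apply, hFb]
    by_cases hkl : k = l
    · subst hkl
      simp only [if_true, Complex.conj_ofReal, smul_eq_mul]
      have h1 : (√|μ (g.symm k)|)⁻¹ * ((√|μ (g.symm k)|)⁻¹ * μ (g.symm k)) =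
          μ (g.symm k) / |μ (g.symm k)| := by
        rw [← mul_assoc, ← mul_inv, Real.mul_self_sqrt (abs_nonneg _), div_eq_inv_mul]
      rw [← Complex.ofReal_mul, ← Complex.ofReal_mul, h1]
      rcases k with k | k
      · have hpos : 0 < μ (g.symm (Sum.inl k)) := ((Fintype.equivFin {i // 0 < μ i}).symm k).2
        rw [abs_of_pos hpos, div_self hpos.ne']
        simp
      · have hneg : ¬0 < μ (g.symm (Sum.inr k)) := ((Fintype.equivFin {i // ¬0 < μ i}).symm k).2
        rw [abs_of_nonpos (not_lt.1 hneg), div_neg, div_self (hμ _)]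
        simp
    · simp [hkl]
  refine ⟨_, _, b'.equivFun, fun x y => ?_⟩
  have hequiv : ∀ k, b'.equivFun (b' k) = Pi.single k 1 := fun k => by
    ext l
    rw [Module.Basis.equivFun_self, Pi.single_apply]
    exact if_congr eq_comm rfl rfl
  have key : F = ((stdForm _ _).comp b'.equivFun.toLinearMap).compl₂ b'.equivFun.toLinearMap := by
    refine b'.ext fun k => b'.ext fun l => ?_
    rw [LinearMap.compl₂_apply, LinearMap.comp_apply, LinearEquiv.coe_coe,
      hequiv, hequiv, stdForm_single, hFb']
  rw [key]
  rfl

/-! ### Orthogonal decomposition into irreducible subrepresentations -/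

section Decomposition

variable {L : Type*} [LieRing L] [LieAlgebra ℝ L] {U : Type u} [AddCommGroup U] [Module ℂ U]

/-- The subspace `W` is an irreducible subrepresentation on which the form is nondegenerate. -/
structure IsIrreducibleNondegenerate (ρ : L →ₗ⁅ℝ⁆ Module.End ℂ U) (F : U →ₗ⋆[ℂ] U →ₗ[ℂ] ℂ)
    (W : Submodule ℂ U) : Prop where
  ne_bot : W ≠ ⊥
  invariant : ∀ x, ∀ w ∈ W, ρ x w ∈ W
  eq_bot_or_eq : ∀ W' ≤ W, (∀ x, ∀ w ∈ W', ρ x w ∈ W') → W' = ⊥ ∨ W' = W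
  eq_zero : ∀ w ∈ W, (∀ v ∈ W, F w v = 0) → w = 0

variable [FiniteDimensional ℂ U]

theorem CompactFrame.exists_isIrreducibleNondegenerate_le (D : CompactFrame L)
    (ρ : L →ₗ⁅ℝ⁆ Module.End ℂ U) {F : U →ₗ⋆[ℂ] U →ₗ[ℂ] ℂ}
    (hρ : ∀ x u v, F (ρ x u) v + F u (ρ x v) = 0) {V : Submodule ℂ U} (hV : V ≠ ⊥)
    (hVinv : ∀ x, ∀ w ∈ V, ρ x w ∈ V) (hVF : ∀ w ∈ V, (∀ v ∈ V, F w v = 0) → w = 0) :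
    ∃ W ≤ V, IsIrreducibleNondegenerate ρ F W := by
  have : Nontrivial V := Submodule.nontrivial_iff_ne_bot.2 hV
  obtain ⟨W, hb, hinv, hirr, hF⟩ := D.exists_irreducible_nondegenerate (restrictRep ρ V hVinv)
    (F := restrict F V) (fun w hw => Subtype.ext (hVF w w.2 fun v hv => hw ⟨v, hv⟩))
    fun x u v => hρ x u v
  refine ⟨W.map V.subtype, V.map_subtype_le W, ?_, ?_, fun W' hW' hinv' => ?_, ?_⟩
  · exact fun h => hb (Submodule.map_injective_of_injective V.subtype_injective
      (by rw [h, Submodule.map_bot]))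
  · rintro x _ ⟨w, hw, rfl⟩
    exact ⟨_, hinv x w hw, rfl⟩
  · have hW'V : W' ≤ V := hW'.trans (V.map_subtype_le W)
    have hmap : (W'.comap V.subtype).map V.subtype = W' := by
      rw [Submodule.map_comap_subtype, inf_eq_right.2 hW'V]
    have := hirr (W'.comap V.subtype) (fun w hw => by
      obtain ⟨w', hw', h⟩ := hW' hw
      rwa [← V.subtype_injective h]) fun x w hw => hinv' x _ hw
    rcases this with h | h
    · left; rw [← hmap, h, Submodule.map_bot]
    · right; rw [← hmap, h]
  · rintro _ ⟨w, hw, rfl⟩ hv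
    rw [hF w hw fun v hv' => hv _ ⟨v, hv', rfl⟩, map_zero]

/-- An invariant subspace on which the form is nondegenerate is an orthogonal sum of irreducible
subrepresentations on which it is nondegenerate, by induction on the dimension: split off one of
these and pass to its orthogonal complement. -/
theorem CompactFrame.exists_orthogonal_decomposition (D : CompactFrame L)
    (ρ : L →ₗ⁅ℝ⁆ Module.End ℂ U) {F : U →ₗ⋆[ℂ] U →ₗ[ℂ] ℂ} (hF : F.IsSymm)
    (hρ : ∀ x u v, F (ρ x u) v + F u (ρ x v) = 0) (N : ℕ) :
    ∀ V : Submodule ℂ U, Module.finrank ℂ V ≤ N → (∀ x, ∀ w ∈ V, ρ x w ∈ V) →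
      (∀ w ∈ V, (∀ v ∈ V, F w v = 0) → w = 0) →
      ∃ (n : ℕ) (W : Fin n → Submodule ℂ U), ⨆ i, W i = V ∧
        (∀ i j, i ≠ j → ∀ x ∈ W i, ∀ y ∈ W j, F x y = 0) ∧
        ∀ i, IsIrreducibleNondegenerate ρ F (W i) := by
  have hsymm : ∀ {x y}, F x y = 0 → F y x = 0 := fun h => hF.isRefl _ _ h
  induction N with
  | zero =>
    intro V hN _ _
    have : V = ⊥ := Submodule.finrank_eq_zero.1 (Nat.le_zero.1 hN)
    exact ⟨0, Fin.elim0, by simp [this], fun i => i.elim0, fun i => i.elim0⟩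
  | succ N ih =>
    intro V hN hVinv hVF
    by_cases hV : V = ⊥
    · exact ⟨0, Fin.elim0, by simp [hV], fun i => i.elim0, fun i => i.elim0⟩
    obtain ⟨W₀, hW₀V, hW₀⟩ := D.exists_isIrreducibleNondegenerate_le ρ hρ hV hVinv hVF
    let V' : Submodule ℂ U := V ⊓ W₀.orthogonalBilin F
    have hV' : ∀ v, v ∈ V' ↔ v ∈ V ∧ ∀ w ∈ W₀, F w v = 0 := fun v => Iff.rfl
    have hsup : W₀ ⊔ V' = V := by
      refine le_antisymm (sup_le hW₀V inf_le_left) fun v hv => ?_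
      obtain ⟨w, hw⟩ := exists_form_eq_of_separatingLeft (F := restrict F W₀)
        (fun w hw => Subtype.ext (hW₀.eq_zero w w.2 fun v hv => hw ⟨v, hv⟩))
        ((F v).comp W₀.subtype)
      refine Submodule.mem_sup.2 ⟨w, w.2, v - w, (hV' _).2 ⟨V.sub_mem hv (hW₀V w.2),
        fun w' hw' => hsymm ?_⟩, by abel⟩
      have : F w w' = F v w' := hw ⟨w', hw'⟩
      rw [map_sub, LinearMap.sub_apply, this, sub_self]
    have hlt : V' < V := by
      refine lt_of_le_of_ne inf_le_left fun h => hW₀.ne_bot ?_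
      rw [eq_bot_iff]
      intro w hw
      have : w ∈ V' := h ▸ hW₀V hw
      exact hW₀.eq_zero w hw fun v hv => hsymm (((hV' w).1 this).2 v hv)
    obtain ⟨n, W, hWV, horth, hW⟩ := ih V'
      (Nat.lt_succ_iff.1 (lt_of_lt_of_le (Submodule.finrank_lt_finrank_of_lt hlt) hN))
      (fun x v hv => (hV' _).2 ⟨hVinv x v ((hV' v).1 hv).1, fun w hw => by
        have := hρ x w v
        rwa [((hV' v).1 hv).2 _ (hW₀.invariant x w hw), zero_add] at this⟩)
      fun v hv hv' => hVF v ((hV' v).1 hv).1 fun u hu => by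
        rw [← hsup] at hu
        obtain ⟨w, hw, v', hv'', rfl⟩ := Submodule.mem_sup.1 hu
        rw [map_add, hsymm (((hV' v).1 hv).2 w hw), hv' v' hv'', add_zero]
    have h0 : ∀ j, ∀ x ∈ W₀, ∀ y ∈ W j, F x y = 0 := fun j x hx y hy =>
      ((hV' y).1 (hWV ▸ Submodule.mem_iSup_of_mem j hy)).2 x hx
    refine ⟨n + 1, Fin.cons W₀ W, ?_, ?_, ?_⟩
    · rw [← hsup, ← hWV]
      refine le_antisymm (iSup_le fun i => ?_) (sup_le ?_ (iSup_le fun i => ?_))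
      · refine Fin.cases ?_ (fun i => ?_) i
        · exact le_sup_left
        · exact (le_iSup W i).trans le_sup_right
      · exact le_iSup (Fin.cons W₀ W : Fin (n + 1) → Submodule ℂ U) 0
      · exact le_iSup (Fin.cons W₀ W : Fin (n + 1) → Submodule ℂ U) i.succ
    · intro i j
      refine Fin.cases (Fin.cases ?_ (fun j => ?_) j) (fun i => Fin.cases ?_ (fun j => ?_) j) i
      · intro h; exact absurd rfl h
      · intro _; exact h0 j
      · intro _ x hx y hy; exact hsymm (h0 i y hy x hx)
      · intro h; exact horth i j fun h' => h (h' ▸ rfl)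
    · intro i
      exact Fin.cases hW₀ hW i

omit [FiniteDimensional ℂ U] in
theorem isInternal_of_orthogonal {F : U →ₗ⋆[ℂ] U →ₗ[ℂ] ℂ} (hF : F.IsSymm) {n : ℕ}
    {W : Fin n → Submodule ℂ U} (htop : ⨆ i, W i = ⊤)
    (horth : ∀ i j, i ≠ j → ∀ x ∈ W i, ∀ y ∈ W j, F x y = 0)
    (hW : ∀ i, ∀ w ∈ W i, (∀ v ∈ W i, F w v = 0) → w = 0) : DirectSum.IsInternal W := by
  refine DirectSum.isInternal_submodule_of_iSupIndep_of_iSup_eq_top (fun i => ?_) htop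
  rw [Submodule.disjoint_def]
  intro x hx hx'
  have hle : ⨆ j, ⨆ (_ : j ≠ i), W j ≤ (W i).orthogonalBilin F :=
    iSup_le fun j => iSup_le fun hj y hy w hw => horth i j hj.symm w hw y hy
  exact hW i x hx fun v hv => hF.isRefl _ _ (hle hx' v hv)

end Decomposition

/-! ### Block-diagonal endomorphisms -/

section Block

variable {U : Type*} [AddCommGroup U] [Module ℂ U] {n : ℕ} {W : Fin n → Submodule ℂ U}

/-- The projection to a summand of an internal direct sum. -/
noncomputable def blockProj (hW : DirectSum.IsInternal W) (i : Fin n) : U →ₗ[ℂ] W i :=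
  DirectSum.component ℂ (Fin n) (fun i => W i) i ∘ₗ
    (LinearEquiv.ofBijective (DirectSum.coeLinearMap W) hW).symm.toLinearMap

variable (hW : DirectSum.IsInternal W)

theorem sum_blockProj (x : U) : ∑ i, (blockProj hW i x : U) = x := by
  let e := LinearEquiv.ofBijective (DirectSum.coeLinearMap W) hW
  have h : DirectSum.coeLinearMap W (e.symm x) = x := e.apply_symm_apply x
  conv_rhs => rw [← h, ← DirectSum.sum_univ_of (e.symm x), map_sum]
  exact Finset.sum_congr rfl fun i _ => (DirectSum.coeLinearMap_lof W i _).symm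

theorem blockProj_apply {i : Fin n} (w : W i) (j : Fin n) :
    blockProj hW j (w : U) = if h : i = j then h ▸ w else 0 := by
  let e := LinearEquiv.ofBijective (DirectSum.coeLinearMap W) hW
  have h : e.symm (w : U) = DirectSum.lof ℂ (Fin n) (fun i => W i) i w := by
    rw [LinearEquiv.symm_apply_eq]
    exact (DirectSum.coeLinearMap_lof W i w).symm
  change DirectSum.component ℂ (Fin n) (fun i => W i) j (e.symm w) = _
  rw [h]
  exact DirectSum.component.of ..

@[simp]
theorem blockProj_self {i : Fin n} (w : W i) : blockProj hW i (w : U) = w := by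
  simp [blockProj_apply]

theorem blockProj_of_ne {i j : Fin n} (hij : i ≠ j) (w : W i) : blockProj hW j (w : U) = 0 := by
  simp [blockProj_apply, hij]

theorem blockProj_sum (y : ∀ i, W i) (j : Fin n) : blockProj hW j (∑ i, (y i : U)) = y j := by
  rw [map_sum, Finset.sum_eq_single j (fun i _ hi => blockProj_of_ne hW hi _) (by simp),
    blockProj_self]

theorem ext_blockProj {x y : U} (h : ∀ i, blockProj hW i x = blockProj hW i y) : x = y := by
  rw [← sum_blockProj hW x, ← sum_blockProj hW y]
  simp only [h]

/-- The block-diagonal endomorphism with given blocks. -/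
noncomputable def blockDiag : (∀ i, Module.End ℂ (W i)) →ₐ[ℂ] Module.End ℂ U :=
  have key : ∀ (A : ∀ i, Module.End ℂ (W i)) x j,
      blockProj hW j ((∑ i, (W i).subtype ∘ₗ A i ∘ₗ blockProj hW i) x) =
        A j (blockProj hW j x) := fun A x j => by
    rw [LinearMap.sum_apply]
    exact blockProj_sum hW (fun i => A i (blockProj hW i x)) j
  AlgHom.ofLinearMap
    { toFun := fun A => ∑ i, (W i).subtype ∘ₗ A i ∘ₗ blockProj hW i
      map_add' := fun A B => LinearMap.ext fun x => ext_blockProj hW fun j => by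
        rw [key, LinearMap.add_apply, map_add, key, key]; rfl
      map_smul' := fun r A => LinearMap.ext fun x => ext_blockProj hW fun j => by
        rw [key, LinearMap.smul_apply, map_smul, key]; rfl }
    (LinearMap.ext fun x => ext_blockProj hW fun j => key _ x j)
    fun A B => LinearMap.ext fun x => ext_blockProj hW fun j => by
      refine (key _ x j).trans ?_
      refine Eq.trans ?_ (key A _ j).symm
      exact congr_arg (A j) (key B x j).symm

theorem blockDiag_eq (A : ∀ i, Module.End ℂ (W i)) :
    blockDiag hW A = ∑ i, (W i).subtype ∘ₗ A i ∘ₗ blockProj hW i := rfl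

@[simp]
theorem blockProj_blockDiag (A : ∀ i, Module.End ℂ (W i)) (x : U) (j : Fin n) :
    blockProj hW j (blockDiag hW A x) = A j (blockProj hW j x) := by
  rw [blockDiag_eq, LinearMap.sum_apply]
  exact blockProj_sum hW (fun i => A i (blockProj hW i x)) j

theorem blockDiag_apply (A : ∀ i, Module.End ℂ (W i)) {i : Fin n} (w : W i) :
    blockDiag hW A w = A i w := by
  refine ext_blockProj hW fun j => ?_
  rw [blockProj_blockDiag]
  by_cases h : i = j
  · subst h; simp
  · rw [blockProj_of_ne hW h, blockProj_of_ne hW h, map_zero]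

theorem eq_blockDiag {A : ∀ i, Module.End ℂ (W i)} {T : Module.End ℂ U}
    (h : ∀ i, ∀ w : W i, T w = A i w) : T = blockDiag hW A := by
  ext x
  rw [← sum_blockProj hW x, map_sum, map_sum]
  exact Finset.sum_congr rfl fun i _ => by rw [h, blockDiag_apply]

theorem trace_blockDiag [FiniteDimensional ℂ U] (A : ∀ i, Module.End ℂ (W i)) :
    LinearMap.trace ℂ U (blockDiag hW A) = ∑ i, LinearMap.trace ℂ (W i) (A i) := by
  rw [blockDiag_eq, map_sum]
  refine Finset.sum_congr rfl fun i _ => ?_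
  rw [LinearMap.trace_comp_comm']
  congr 1
  ext w
  simp

variable {F : U →ₗ⋆[ℂ] U →ₗ[ℂ] ℂ}

theorem form_eq_sum (horth : ∀ i j, i ≠ j → ∀ x ∈ W i, ∀ y ∈ W j, F x y = 0) (x y : U) :
    F x y = ∑ i, F (blockProj hW i x) (blockProj hW i y) := by
  conv_lhs => rw [← sum_blockProj hW x, ← sum_blockProj hW y]
  simp only [map_sum, LinearMap.sum_apply]
  refine Finset.sum_congr rfl fun i _ => ?_
  exact Finset.sum_eq_single i
    (fun j _ hj => horth j i hj _ (blockProj hW j x).2 _ (blockProj hW i y).2) (by simp)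

variable [FiniteDimensional ℂ U]

theorem blockDiag_mem_su (horth : ∀ i j, i ≠ j → ∀ x ∈ W i, ∀ y ∈ W j, F x y = 0)
    {A : ∀ i, Module.End ℂ (W i)} (hA : ∀ i, A i ∈ su (restrict F (W i))) :
    blockDiag hW A ∈ su F := by
  refine ⟨fun u v => ?_, ?_⟩
  · rw [form_eq_sum hW horth, form_eq_sum hW horth u, ← Finset.sum_add_distrib]
    refine Finset.sum_eq_zero fun i _ => ?_
    rw [blockProj_blockDiag, blockProj_blockDiag]
    exact (hA i).1 _ _
  · rw [trace_blockDiag]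
    exact Finset.sum_eq_zero fun i _ => (hA i).2

/-- The block-diagonal inclusion `⨁ su(Wᵢ, F|Wᵢ) → su(U, F)`. -/
noncomputable def blockInclusion
    (horth : ∀ i j, i ≠ j → ∀ x ∈ W i, ∀ y ∈ W j, F x y = 0) :
    (⨁ i, su (restrict F (W i))) →ₗ⁅ℝ⁆ su F where
  toFun X := ⟨blockDiag hW fun i => (X i).1, blockDiag_mem_su hW horth fun i => (X i).2⟩
  map_add' X Y := Subtype.ext (map_add (blockDiag hW) (fun i => (X i).1) fun i => (Y i).1)
  map_smul' r X := by
    refine Subtype.ext ?_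
    have h : (fun i => ((r • X) i).1) = (r : ℂ) • fun i => (X i).1 :=
      funext fun i => real_smul_end r _
    change blockDiag hW (fun i => ((r • X) i).1) = r • blockDiag hW fun i => (X i).1
    rw [h, map_smul, real_smul_end]
  map_lie' {X Y} := by
    refine Subtype.ext ?_
    have h : (fun i => (⁅X, Y⁆ i).1) =
        (fun i => (X i).1) * (fun i => (Y i).1) - (fun i => (Y i).1) * fun i => (X i).1 :=
      funext fun i => by rw [DirectSum.bracket_apply]; rfl
    change blockDiag hW (fun i => (⁅X, Y⁆ i).1) = blockDiag hW (fun i => (X i).1) *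
      blockDiag hW (fun i => (Y i).1) - blockDiag hW (fun i => (Y i).1) *
      blockDiag hW (fun i => (X i).1)
    rw [h, map_sub, map_mul, map_mul]

theorem coe_blockInclusion (horth : ∀ i j, i ≠ j → ∀ x ∈ W i, ∀ y ∈ W j, F x y = 0)
    (X : ⨁ i, su (restrict F (W i))) :
    (blockInclusion hW horth X : Module.End ℂ U) = blockDiag hW fun i => (X i).1 := rfl

theorem blockInclusion_injective (horth : ∀ i j, i ≠ j → ∀ x ∈ W i, ∀ y ∈ W j, F x y = 0) :
    Function.Injective (blockInclusion hW horth) := by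
  intro X Y h
  refine DFinsupp.ext fun i => Subtype.ext (LinearMap.ext fun w => Subtype.ext ?_)
  rw [← blockDiag_apply hW (fun i => (X i).1), ← blockDiag_apply hW (fun i => (Y i).1)]
  exact LinearMap.congr_fun (congr_arg Subtype.val h) w

/-! ### Holomorphy of the block-diagonal inclusion -/

omit [FiniteDimensional ℂ U] in
/-- The base point whose positive and negative subspaces are the sums of those of the given base
points. -/
noncomputable def blockBasePoint (horth : ∀ i j, i ≠ j → ∀ x ∈ W i, ∀ y ∈ W j, F x y = 0)
    (o : ∀ i, BasePoint (restrict F (W i))) : BasePoint F where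
  pos := ⨅ i, (o i).pos.comap (blockProj hW i)
  neg := ⨅ i, (o i).neg.comap (blockProj hW i)
  isCompl := by
    rw [isCompl_iff, Submodule.disjoint_def, codisjoint_iff, Submodule.eq_top_iff']
    simp only [Submodule.mem_iInf, Submodule.mem_comap, Submodule.mem_sup]
    refine ⟨fun x hx hx' => ext_blockProj hW fun i => ?_, fun x =>
      ⟨blockDiag hW (fun i => (o i).projPos) x, fun i => ?_,
        blockDiag hW (fun i => (o i).projNeg) x, fun i => ?_, ?_⟩⟩
    · rw [map_zero]
      exact Submodule.disjoint_def.1 (o i).isCompl.disjoint _ (hx i) (hx' i)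
    · rw [blockProj_blockDiag]
      exact Submodule.projection_apply_mem _ _
    · rw [blockProj_blockDiag]
      exact Submodule.projection_apply_mem _ _
    · refine ext_blockProj hW fun i => ?_
      rw [map_add, blockProj_blockDiag, blockProj_blockDiag]
      exact LinearMap.congr_fun (o i).projPos_add_projNeg _
  orthogonal x hx y hy := by
    simp only [Submodule.mem_iInf, Submodule.mem_comap] at hx hy
    rw [form_eq_sum hW horth, form_eq_sum hW horth y]
    exact ⟨Finset.sum_eq_zero fun i _ => ((o i).orthogonal _ (hx i) _ (hy i)).1,
      Finset.sum_eq_zero fun i _ => ((o i).orthogonal _ (hx i) _ (hy i)).2⟩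
  pos_def x hx hx0 := by
    simp only [Submodule.mem_iInf, Submodule.mem_comap] at hx
    rw [form_eq_sum hW horth, Complex.re_sum]
    have h0 : ∃ i, blockProj hW i x ≠ 0 := by
      by_contra! h
      exact hx0 (ext_blockProj hW fun i => by rw [h, map_zero])
    obtain ⟨i, hi⟩ := h0
    refine Finset.sum_pos' (fun j _ => ?_) ⟨i, Finset.mem_univ i, (o i).pos_def _ (hx i) hi⟩
    by_cases hj : blockProj hW j x = 0
    · simp [hj]
    · exact ((o j).pos_def _ (hx j) hj).le
  neg_def x hx hx0 := by
    simp only [Submodule.mem_iInf, Submodule.mem_comap] at hx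
    rw [form_eq_sum hW horth, Complex.re_sum]
    have h0 : ∃ i, blockProj hW i x ≠ 0 := by
      by_contra! h
      exact hx0 (ext_blockProj hW fun i => by rw [h, map_zero])
    obtain ⟨i, hi⟩ := h0
    refine Finset.sum_neg' (fun j _ => ?_) ⟨i, Finset.mem_univ i, (o i).neg_def _ (hx i) hi⟩
    by_cases hj : blockProj hW j x = 0
    · simp [hj]
    · exact ((o j).neg_def _ (hx j) hj).le

omit [FiniteDimensional ℂ U] in
theorem σ_blockBasePoint (horth : ∀ i j, i ≠ j → ∀ x ∈ W i, ∀ y ∈ W j, F x y = 0)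
    (o : ∀ i, BasePoint (restrict F (W i))) :
    (blockBasePoint hW horth o).σ = blockDiag hW fun i => (o i).σ := by
  have hpos : (blockBasePoint hW horth o).projPos = blockDiag hW fun i => (o i).projPos := by
    ext x
    have hsum : blockDiag hW (fun i => (o i).projPos) x +
        blockDiag hW (fun i => (o i).projNeg) x = x := by
      refine ext_blockProj hW fun i => ?_
      rw [map_add, blockProj_blockDiag, blockProj_blockDiag]
      exact LinearMap.congr_fun (o i).projPos_add_projNeg _
    have h1 : blockDiag hW (fun i => (o i).projPos) x ∈ (blockBasePoint hW horth o).pos := by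
      simp only [blockBasePoint, Submodule.mem_iInf, Submodule.mem_comap, blockProj_blockDiag]
      exact fun i => Submodule.projection_apply_mem _ _
    have h2 : blockDiag hW (fun i => (o i).projNeg) x ∈ (blockBasePoint hW horth o).neg := by
      simp only [blockBasePoint, Submodule.mem_iInf, Submodule.mem_comap, blockProj_blockDiag]
      exact fun i => Submodule.projection_apply_mem _ _
    conv_lhs => rw [← hsum]
    rw [map_add, BasePoint.projPos, Submodule.projection_apply_of_mem_left _ h1,
      (Submodule.projection_apply_eq_zero_iff _).2 h2, add_zero]
  rw [BasePoint.σ_eq, hpos, ← map_one (blockDiag hW), ← map_smul, ← map_sub]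
  congr 1
  ext i : 1
  exact (o i).σ_eq.symm

/-- The block-diagonal inclusion is holomorphic. -/
theorem isHolomorphicAt_blockInclusion
    (horth : ∀ i j, i ≠ j → ∀ x ∈ W i, ∀ y ∈ W j, F x y = 0)
    (o : ∀ i, BasePoint (restrict F (W i))) :
    IsHolomorphicAt (HermitianDecomposition.directSum fun i => (o i).decomposition)
      (blockBasePoint hW horth o).decomposition (blockInclusion hW horth) := by
  refine ⟨fun X hX => ?_, fun X hX => ?_, fun X _ => Subtype.ext ?_⟩
  · change _ * (blockInclusion hW horth X : Module.End ℂ U) = blockInclusion hW horth X * _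
    rw [coe_blockInclusion, σ_blockBasePoint, ← map_mul, ← map_mul]
    congr 1
    ext i : 1
    exact hX i
  · change _ * (blockInclusion hW horth X : Module.End ℂ U) = -(blockInclusion hW horth X * _)
    rw [coe_blockInclusion, σ_blockBasePoint, ← map_mul, ← map_mul, ← map_neg]
    congr 1
    ext i : 1
    exact hX i
  · change _ = (blockBasePoint hW horth o).zEnd * (blockInclusion hW horth X : Module.End ℂ U) -
      blockInclusion hW horth X * (blockBasePoint hW horth o).zEnd
    rw [BasePoint.zEnd_lie, coe_blockInclusion, coe_blockInclusion, σ_blockBasePoint, ← map_mul,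
      ← map_mul, ← map_sub, ← map_smul]
    congr 1
    ext i : 1
    rw [DirectSum.bracket_apply]
    exact (o i).zEnd_lie (X i)

end Block

/-! ### Cartan data -/

/-- A semisimple real Lie algebra of Hermitian type: a Cartan involution `θ` with an inner product
`P` for which the adjoint of `ad x` is `-ad (θ x)`, an element `Z` of the centre of the fixed
algebra of `θ` which induces a complex structure on the `-1`-eigenspace, and zero centre. -/
structure CartanData (L : Type*) [LieRing L] [LieAlgebra ℝ L] where
  /-- the inner product -/
  P : L →ₗ[ℝ] L →ₗ[ℝ] ℝ
  /-- the Cartan involution -/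
  θ : L →ₗ[ℝ] L
  /-- the element inducing the complex structure -/
  Z : L
  finite : FiniteDimensional ℝ L
  symm : ∀ x y, P x y = P y x
  pos : ∀ x, x ≠ 0 → 0 < P x x
  θ_θ : ∀ x, θ (θ x) = x
  θ_lie : ∀ x y, θ ⁅x, y⁆ = ⁅θ x, θ y⁆
  P_θ : ∀ x y, P (θ x) y = P x (θ y)
  P_lie : ∀ x y w, P ⁅x, y⁆ w = -P y ⁅θ x, w⁆
  θ_Z : θ Z = Z
  lie_Z : ∀ x, ⁅Z, x + θ x⁆ = 0
  lie_Z_Z : ∀ x, ⁅Z, ⁅Z, x - θ x⁆⁆ = -(x - θ x)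
  center : ∀ x : L, (∀ y : L, ⁅x, y⁆ = 0) → x = 0

section Frame

variable {L : Type*} [LieRing L] [LieAlgebra ℝ L]

/-- The Cartan involution is symmetric for the inner product, hence diagonalizable. -/
theorem CartanData.exists_eigenbasis (D : CartanData L) :
    ∃ (n : ℕ) (b : Module.Basis (Fin n) ℝ L) (ε : Fin n → ℝ),
      (∀ i, D.θ (b i) = ε i • b i) ∧ ∀ i j, D.P (b i) (b j) = if i = j then 1 else 0 := by
  have := D.finite
  let core : InnerProductSpace.Core ℝ L :=
    { inner := fun x y => D.P x y
      conj_inner_symm := fun x y => D.symm y x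
      re_inner_nonneg := fun x => by
        by_cases hx : x = 0
        · simp [hx]
        · exact (D.pos x hx).le
      add_left := fun x y z => by simp
      smul_left := fun x y r => by simp
      definite := fun x hx => by
        by_contra hne
        exact (D.pos x hne).ne' hx }
  let : NormedAddCommGroup L := core.toNormedAddCommGroup
  let : InnerProductSpace ℝ L := InnerProductSpace.ofCore core.toCore
  have hinner : ∀ x y : L, inner ℝ x y = D.P x y := fun x y => rfl
  have hsym : D.θ.IsSymmetric := fun x y => by rw [hinner, hinner, D.P_θ]
  let b := hsym.eigenvectorBasis rfl
  refine ⟨_, b.toBasis, hsym.eigenvalues rfl, fun i => ?_, fun i j => ?_⟩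
  · rw [OrthonormalBasis.coe_toBasis]
    exact hsym.apply_eigenvectorBasis rfl i
  · rw [OrthonormalBasis.coe_toBasis, ← hinner]
    exact orthonormal_iff_ite.1 b.orthonormal i j

/-- An orthonormal eigenbasis of the Cartan involution is a compact frame. -/
theorem CartanData.nonempty_compactFrame (D : CartanData L) : Nonempty (CompactFrame L) := by
  obtain ⟨n, b, ε, hε, hb⟩ := D.exists_eigenbasis
  have hε1 : ∀ a, ε a = 1 ∨ ε a = -1 := by
    intro a
    have h := D.θ_θ (b a)
    rw [hε, map_smul, hε, smul_smul] at h
    have h' := congr_arg (fun x => D.P x (b a)) h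
    simp only [map_smul, LinearMap.smul_apply, hb, if_true, smul_eq_mul, mul_one] at h'
    exact mul_self_eq_one_iff.1 h'
  have hexp : ∀ x, x = ∑ d, D.P x (b d) • b d := by
    intro x
    conv_lhs => rw [← b.sum_repr x]
    refine Finset.sum_congr rfl fun d _ => ?_
    congr 1
    have h : D.P x (b d) = D.P (∑ i, b.repr x i • b i) (b d) := by rw [b.sum_repr]
    rw [h]
    simp only [map_sum, map_smul, LinearMap.sum_apply, LinearMap.smul_apply, hb, smul_eq_mul,
      mul_ite, mul_one, mul_zero, Finset.sum_ite_eq', Finset.mem_univ, if_true]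
  let e : Fin n → Fin n → Fin n → ℝ := fun a i d => D.P ⁅b a, b i⁆ (b d)
  have he_def : ∀ a i d, e a i d = D.P ⁅b a, b i⁆ (b d) := fun _ _ _ => rfl
  have he_parity : ∀ a i d, ε a * ε i * e a i d = ε d * e a i d := by
    intro a i d
    have h := D.P_θ ⁅b a, b i⁆ (b d)
    rw [D.θ_lie, hε, hε, hε, smul_lie, lie_smul, map_smul, map_smul, map_smul,
      LinearMap.smul_apply, LinearMap.smul_apply] at h
    simp only [smul_eq_mul] at h
    rw [mul_assoc]
    exact h
  have he_left : ∀ a i d, e i a d = -e a i d := by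
    intro a i d
    rw [he_def, ← lie_skew, map_neg, LinearMap.neg_apply]
  have he_right : ∀ a i d, e a d i = -(ε a * e a i d) := by
    intro a i d
    rw [he_def, D.P_lie, hε, smul_lie, map_smul, D.symm]
    rfl
  -- the sign `s a * s i / s d` in all cases in which `e a i d` does not vanish by parity
  let κ : Fin n → Fin n → ℝ := fun a i => (1 + ε a + ε i - ε a * ε i) / 2
  have hκ : ∀ a i, κ a i ≠ 0 := by
    intro a i
    rcases hε1 a with h | h <;> rcases hε1 i with h' | h' <;> simp only [κ, h, h'] <;> norm_num
  let s : Fin n → ℂ := fun a => if ε a = 1 then 1 else Complex.I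
  have hs1 : ∀ a, ε a = 1 → s a = 1 := fun a h => if_pos h
  have hsI : ∀ a, ε a = -1 → s a = Complex.I := fun a h => if_neg (by rw [h]; norm_num)
  refine ⟨{ n := n, X := b, s := s, e := e, c := fun a i d => κ a i * e a i d, Z := D.Z,
            span_eq_top := b.span_eq, lie_eq := fun a i => hexp _, scale := fun a i d => ?_,
            compact := ⟨fun a i d => ?_, fun a i d => ?_, fun t ht => ?_⟩,
            lie_Z := fun a => ?_, Z_mem := ?_ }⟩
  · have hp := he_parity a i d
    by_cases h0 : e a i d = 0
    · simp [h0]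
    have hp' := mul_right_cancel₀ h0 hp
    rcases hε1 a with h | h <;> rcases hε1 i with h' | h' <;> rw [h, h'] at hp' <;>
      simp only [h, h', κ, hs1, hsI]
    · rw [hs1 d (by linarith)]; push_cast; ring
    · rw [hsI d (by linarith)]; push_cast; ring
    · rw [hsI d (by linarith)]; push_cast; ring
    · rw [hs1 d (by linarith), Complex.I_mul_I]; push_cast; ring
  · simp only [κ, he_left a i d]
    ring
  · have hp := he_parity a i d
    by_cases h0 : e a i d = 0
    · simp [h0, he_right a i d]
    have hp' := mul_right_cancel₀ h0 hp
    rw [he_right a i d]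
    simp only [κ, ← hp']
    rcases hε1 a with h | h <;> rw [h] <;> ring
  · have hreal : ∀ r : Fin n → ℝ, (∀ a i, ∑ d, e a i d * r d = 0) → r = 0 := by
      intro r hr
      have hR : ∑ d, r d • b d = 0 := by
        refine D.center _ fun y => ?_
        have hy : ∀ a, ⁅∑ d, r d • b d, b a⁆ = 0 := by
          intro a
          rw [hexp ⁅_, b a⁆]
          refine Finset.sum_eq_zero fun i _ => ?_
          have h1 : D.P ⁅b a, b i⁆ (∑ d, r d • b d) = 0 := by
            rw [map_sum, ← hr a i]
            exact Finset.sum_congr rfl fun d _ => by rw [map_smul, smul_eq_mul, mul_comm]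
          rw [D.P_lie, hε, smul_lie, map_smul, ← lie_skew, map_neg, D.symm, smul_eq_mul] at h1
          have h2 : ε a ≠ 0 := by rcases hε1 a with h | h <;> rw [h] <;> norm_num
          have h3 : D.P ⁅∑ d, r d • b d, b a⁆ (b i) = 0 := by
            simpa [h2] using h1
          rw [h3, zero_smul]
        rw [← b.sum_repr y, lie_sum]
        exact Finset.sum_eq_zero fun a _ => by rw [lie_smul, hy, smul_zero]
      exact funext fun d => Fintype.linearIndependent_iff.1 b.linearIndependent r hR d
    have ht' : ∀ a i, ∑ d, (e a i d : ℂ) * t d = 0 := by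
      intro a i
      have h := ht a i
      simp only [Complex.ofReal_mul, mul_assoc, ← Finset.mul_sum] at h
      exact (mul_eq_zero.1 h).resolve_left (by exact_mod_cast hκ a i)
    have hre := hreal (fun d => (t d).re) fun a i => by
      simpa using congr_arg Complex.re (ht' a i)
    have him := hreal (fun d => (t d).im) fun a i => by
      simpa using congr_arg Complex.im (ht' a i)
    exact funext fun d => Complex.ext (congr_fun hre d) (congr_fun him d)
  · rcases hε1 a with h | h
    · refine Or.inl ⟨hs1 a h, ?_⟩
      have := D.lie_Z (b a)
      rw [hε, h, one_smul, lie_add, ← two_smul ℝ] at this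
      exact (smul_eq_zero_iff_right two_ne_zero).1 this
    · refine Or.inr ⟨hsI a h, ?_⟩
      have := D.lie_Z_Z (b a)
      rw [hε, h, neg_one_smul, sub_neg_eq_add, ← two_smul ℝ, lie_smul, lie_smul, ← smul_neg] at this
      exact smul_right_injective L (two_ne_zero' ℝ) this
  · rw [hexp D.Z]
    refine Submodule.sum_mem _ fun d _ => ?_
    rcases hε1 d with h | h
    · exact Submodule.smul_mem _ _ (Submodule.subset_span ⟨d, hs1 d h, rfl⟩)
    · have h1 := D.P_θ D.Z (b d)
      rw [D.θ_Z, hε, h, neg_one_smul, map_neg] at h1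
      rw [self_eq_neg.1 h1, zero_smul]
      exact Submodule.zero_mem _

end Frame

/-! ### Transport and products of Cartan data -/

/-- Transport of Cartan data along an isomorphism. -/
noncomputable def CartanData.ofEquiv {L M : Type*} [LieRing L] [LieAlgebra ℝ L] [LieRing M]
    [LieAlgebra ℝ M] (D : CartanData L) (f : M ≃ₗ⁅ℝ⁆ L) : CartanData M where
  P := D.P.compl₁₂ f.toLinearEquiv.toLinearMap f.toLinearEquiv.toLinearMap
  θ := f.symm.toLinearEquiv.toLinearMap ∘ₗ D.θ ∘ₗ f.toLinearEquiv.toLinearMap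
  Z := f.symm D.Z
  finite := have := D.finite; LinearEquiv.finiteDimensional f.symm.toLinearEquiv
  symm x y := D.symm _ _
  pos x hx := D.pos _ fun h => hx (f.injective (h.trans (map_zero f).symm))
  θ_θ x := by simp [D.θ_θ]
  θ_lie x y := by simp [D.θ_lie, LieEquiv.map_lie]
  P_θ x y := by simp [D.P_θ]
  P_lie x y w := by simp [D.P_lie, LieEquiv.map_lie]
  θ_Z := by simp [D.θ_Z]
  lie_Z x := f.injective (by simpa [LieEquiv.map_lie] using D.lie_Z (f x))
  lie_Z_Z x := f.injective (by simpa [LieEquiv.map_lie] using D.lie_Z_Z (f x))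
  center x hx := f.injective (by
    rw [map_zero]
    refine D.center _ fun y => ?_
    have := congr_arg f (hx (f.symm y))
    simpa [LieEquiv.map_lie] using this)

/-- Cartan data on a finite direct sum. -/
noncomputable def CartanData.directSum {k : ℕ} {L : Fin k → Type*} [∀ i, LieRing (L i)]
    [∀ i, LieAlgebra ℝ (L i)] (D : ∀ i, CartanData (L i)) : CartanData (⨁ i, L i) where
  P := ∑ i, (D i).P.compl₁₂ (DirectSum.component ℝ _ L i) (DirectSum.component ℝ _ L i)
  θ := DirectSum.lmap fun i => (D i).θ
  Z := DFinsupp.equivFunOnFintype.symm fun i => (D i).Z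
  finite := have := fun i => (D i).finite
    (DirectSum.linearEquivFunOnFintype ℝ (Fin k) L).symm.finiteDimensional
  symm x y := by simp [LinearMap.sum_apply, (D _).symm]
  pos x hx := by
    have h0 : ∃ i, x i ≠ 0 := by
      by_contra! h
      exact hx (DFinsupp.ext h)
    obtain ⟨i, hi⟩ := h0
    simp only [LinearMap.sum_apply, LinearMap.compl₁₂_apply]
    refine Finset.sum_pos' (fun j _ => ?_) ⟨i, Finset.mem_univ i, (D i).pos _ hi⟩
    by_cases hj : DirectSum.component ℝ _ L j x = 0
    · simp [hj]
    · exact ((D j).pos _ hj).le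
  θ_θ x := DFinsupp.ext fun i => (D i).θ_θ _
  θ_lie x y := DFinsupp.ext fun i => (D i).θ_lie _ _
  P_θ x y := by
    simp only [LinearMap.sum_apply, LinearMap.compl₁₂_apply]
    exact Finset.sum_congr rfl fun i _ => (D i).P_θ _ _
  P_lie x y w := by
    simp only [LinearMap.sum_apply, LinearMap.compl₁₂_apply, ← Finset.sum_neg_distrib]
    exact Finset.sum_congr rfl fun i _ => (D i).P_lie _ _ _
  θ_Z := DFinsupp.ext fun i => (D i).θ_Z
  lie_Z x := DFinsupp.ext fun i => (D i).lie_Z _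
  lie_Z_Z x := DFinsupp.ext fun i => (D i).lie_Z_Z _
  center x hx := DFinsupp.ext fun i => (D i).center _ fun y => by
    have := congr_arg (fun z => z i) (hx (DirectSum.of L i y))
    simpa using this

/-- A Lie algebra which is the internal direct sum of ideals is isomorphic to their direct sum. -/
theorem nonempty_equiv_directSum_of_isInternal {L : Type*} [LieRing L] [LieAlgebra ℝ L] {k : ℕ}
    {I : Fin k → LieIdeal ℝ L} (hI : DirectSum.IsInternal fun i => (I i).toSubmodule) :
    Nonempty (L ≃ₗ⁅ℝ⁆ ⨁ i, I i) := by
  have hcomm : Pairwise fun i j => ∀ (x : I i) (y : I j), ⁅(I i).incl x, (I j).incl y⁆ = 0 := by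
    intro i j hij x y
    have hd := hI.submodule_iSupIndep.pairwiseDisjoint hij
    exact Submodule.disjoint_def.1 hd _ (lie_mem_left ℝ L (I i) x y x.2)
      (lie_mem_right ℝ L (I j) x y y.2)
  exact ⟨(LieEquiv.ofBijective (DirectSum.toLieAlgebra L (fun i => (I i).incl) hcomm) hI).symm⟩

/-! ### Cartan data of the special unitary algebras -/

section SU

variable {U : Type*} [AddCommGroup U] [Module ℂ U] {F : U →ₗ⋆[ℂ] U →ₗ[ℂ] ℂ}

/-- The positive definite form `F(x, σ y)` attached to a base point. -/
theorem BasePoint.isInner (o : BasePoint F) (hF : F.IsSymm) : IsInner (F.compl₂ o.σ) := by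
  refine ⟨fun x y => ?_, fun x hx => ?_⟩
  · rw [LinearMap.compl₂_apply, LinearMap.compl₂_apply, hF.eq, o.form_σ]
  · have h1 : o.projPos x + o.projNeg x = x := LinearMap.congr_fun o.projPos_add_projNeg x
    have hp : o.projPos x ∈ o.pos := Submodule.projection_apply_mem _ _
    have hn : o.projNeg x ∈ o.neg := Submodule.projection_apply_mem _ _
    have h2 : F x (o.σ x) = F (o.projPos x) (o.projPos x) - F (o.projNeg x) (o.projNeg x) := by
      conv_lhs => rw [← h1]
      have h3 : o.σ (o.projPos x + o.projNeg x) = o.projPos x - o.projNeg x := by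
        rw [h1, BasePoint.σ, LinearMap.sub_apply]
      rw [h3, map_add, LinearMap.add_apply, map_sub, map_sub, (o.orthogonal _ hp _ hn).1,
        (o.orthogonal _ hp _ hn).2]
      ring
    have h0 : ∀ y ∈ o.pos, 0 ≤ (F y y).re := fun y hy => by
      by_cases hy0 : y = 0
      · simp [hy0]
      · exact (o.pos_def y hy hy0).le
    have h0' : ∀ y ∈ o.neg, (F y y).re ≤ 0 := fun y hy => by
      by_cases hy0 : y = 0
      · simp [hy0]
      · exact (o.neg_def y hy hy0).le
    rw [LinearMap.compl₂_apply, h2, Complex.sub_re]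
    by_cases hP : o.projPos x = 0
    · have hN : o.projNeg x ≠ 0 := fun hN => hx (by rw [← h1, hP, hN, add_zero])
      have := o.neg_def _ hn hN
      have := h0 _ hp
      linarith
    · have := o.pos_def _ hp hP
      have := h0' _ hn
      linarith

variable [FiniteDimensional ℂ U]

/-- If `B` is the adjoint of a nonzero `A` for an inner product then `B A` has positive trace. -/
theorem IsInner.trace_pos {h : U →ₗ⋆[ℂ] U →ₗ[ℂ] ℂ} (hh : IsInner h) {A B : Module.End ℂ U}
    (hAB : ∀ x y, h (A x) y = h x (B y)) (hA : A ≠ 0) : 0 < (LinearMap.trace ℂ U (B * A)).re := by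
  obtain ⟨b, -, -, hb⟩ := hh.exists_eigenbasis (S := 0) (by simp)
  have hrepr : ∀ x i, b.repr x i = h (b i) x := by
    intro x i
    have : h (b i) x = h (b i) (∑ j, b.repr x j • b j) := by rw [b.sum_repr]
    rw [this]
    simp only [map_sum, map_smul, hb, smul_eq_mul, mul_ite, mul_one, mul_zero, Finset.sum_ite_eq,
      Finset.mem_univ, if_true]
  rw [LinearMap.trace_eq_matrix_trace ℂ b, Matrix.trace, Complex.re_sum]
  have hdiag : ∀ i, (LinearMap.toMatrix b b (B * A)).diag i = h (A (b i)) (A (b i)) := by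
    intro i
    rw [Matrix.diag_apply, LinearMap.toMatrix_apply, hrepr, Module.End.mul_apply, hAB]
  simp only [hdiag]
  have hne : ∃ i, A (b i) ≠ 0 := by
    by_contra! h0
    exact hA (b.ext h0)
  obtain ⟨i, hi⟩ := hne
  refine Finset.sum_pos' (fun j _ => ?_) ⟨i, Finset.mem_univ i, hh.pos _ hi⟩
  by_cases hj : A (b j) = 0
  · simp [hj]
  · exact (hh.pos _ hj).le

/-- A base point defines Cartan data on `su(U, F)`, if the centre of this algebra is zero. The
inner product is `-Re tr(X σ Y σ)`, the Cartan involution is conjugation by `σ`. -/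
noncomputable def BasePoint.cartanData (o : BasePoint F) (hF : F.IsSymm)
    (hcenter : ∀ X : su F, (∀ Y : su F, ⁅X, Y⁆ = 0) → X = 0) : CartanData (su F) where
  P := LinearMap.mk₂ ℝ
    (fun X Y => -(LinearMap.trace ℂ U ((X : Module.End ℂ U) * o.σ * Y * o.σ)).re)
    (fun X X' Y => by simp [add_mul]; ring)
    (fun r X Y => by
      rw [show ((r • X : su F) : Module.End ℂ U) = (r : ℂ) • X from real_smul_end r X.1,
        smul_mul_assoc, smul_mul_assoc, smul_mul_assoc, map_smul, smul_eq_mul,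
        Complex.re_ofReal_mul, smul_eq_mul, mul_neg])
    (fun X Y Y' => by simp [add_mul, mul_add]; ring)
    (fun r X Y => by
      rw [show ((r • Y : su F) : Module.End ℂ U) = (r : ℂ) • Y from real_smul_end r Y.1,
        mul_smul_comm, smul_mul_assoc, map_smul, smul_eq_mul,
        Complex.re_ofReal_mul, smul_eq_mul, mul_neg])
  θ :=
    { toFun := fun X => ⟨o.σ * X * o.σ, o.conj_σ_mem X.2⟩
      map_add' := fun X Y => Subtype.ext (by simp [mul_add, add_mul])
      map_smul' := fun r X => Subtype.ext (by simp) }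
  Z := o.Z
  finite := by
    have : FiniteDimensional ℝ (Module.End ℂ U) := FiniteDimensional.complexToReal _
    exact FiniteDimensional.finiteDimensional_submodule (su F).toSubmodule
  symm X Y := by
    simp only [LinearMap.mk₂_apply]
    rw [mul_assoc, LinearMap.trace_mul_comm, ← mul_assoc]
  pos X hX := by
    simp only [LinearMap.mk₂_apply]
    have hσ := o.σ_mul_σ
    have hne : -(o.σ * (X : Module.End ℂ U) * o.σ) ≠ 0 := fun h0 => hX (Subtype.ext (by
      have h1 : o.σ * -(o.σ * (X : Module.End ℂ U) * o.σ) * o.σ = -X := by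
        rw [mul_neg, neg_mul, ← mul_assoc, ← mul_assoc, hσ, one_mul, mul_assoc, hσ, mul_one]
      rw [h0, mul_zero, zero_mul] at h1
      exact (neg_eq_zero.1 h1.symm)))
    have := (o.isInner hF).trace_pos (A := -(o.σ * (X : Module.End ℂ U) * o.σ))
      (B := (X : Module.End ℂ U)) (fun x y => by
        have h1 := X.2.1 (o.σ x) y
        rw [LinearMap.compl₂_apply, LinearMap.compl₂_apply, ← o.form_σ, ← o.form_σ,
          LinearMap.neg_apply, Module.End.mul_apply, Module.End.mul_apply]
        have h2 : o.σ (o.σ ((X : Module.End ℂ U) (o.σ x))) = (X : Module.End ℂ U) (o.σ x) :=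
          LinearMap.congr_fun hσ _
        rw [map_neg, h2, map_neg, LinearMap.neg_apply]
        linear_combination -h1) hne
    rwa [mul_neg, map_neg, Complex.neg_re, ← mul_assoc, ← mul_assoc] at this
  θ_θ X := Subtype.ext (by
    change o.σ * (o.σ * (X : Module.End ℂ U) * o.σ) * o.σ = X
    rw [← mul_assoc, ← mul_assoc, o.σ_mul_σ, one_mul, mul_assoc, o.σ_mul_σ, mul_one])
  θ_lie X Y := Subtype.ext (by
    have h : ∀ A B : Module.End ℂ U, o.σ * A * o.σ * (o.σ * B * o.σ) = o.σ * (A * B) * o.σ := by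
      intro A B
      rw [← mul_assoc, ← mul_assoc, mul_assoc _ o.σ o.σ, o.σ_mul_σ, mul_one, mul_assoc o.σ A B]
    change o.σ * ((X : Module.End ℂ U) * Y - Y * X) * o.σ = o.σ * X * o.σ * (o.σ * Y * o.σ) -
      o.σ * Y * o.σ * (o.σ * X * o.σ)
    rw [h, h, mul_sub, sub_mul])
  P_θ X Y := by
    change -(LinearMap.trace ℂ U (o.σ * (X : Module.End ℂ U) * o.σ * o.σ * Y * o.σ)).re =
      -(LinearMap.trace ℂ U (X * o.σ * (o.σ * Y * o.σ) * o.σ)).re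
    have h1 : o.σ * (X : Module.End ℂ U) * o.σ * o.σ * Y * o.σ = o.σ * (X * Y * o.σ) := by
      rw [mul_assoc _ o.σ o.σ, o.σ_mul_σ, mul_one]
      simp only [mul_assoc]
    have h2 : (X : Module.End ℂ U) * o.σ * (o.σ * Y * o.σ) * o.σ = X * Y := by
      rw [← mul_assoc, ← mul_assoc, mul_assoc _ o.σ o.σ, o.σ_mul_σ, mul_one, mul_assoc _ o.σ o.σ,
        o.σ_mul_σ, mul_one]
    rw [h1, h2, LinearMap.trace_mul_comm, mul_assoc _ o.σ o.σ, o.σ_mul_σ, mul_one]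
  P_lie X Y V := by
    change -(LinearMap.trace ℂ U (((X : Module.End ℂ U) * Y - Y * X) * o.σ * V * o.σ)).re =
      - -(LinearMap.trace ℂ U ((Y : Module.End ℂ U) * o.σ * (o.σ * X * o.σ * V -
        V * (o.σ * X * o.σ)) * o.σ)).re
    have h1 : (Y : Module.End ℂ U) * o.σ * (o.σ * X * o.σ * V - V * (o.σ * X * o.σ)) * o.σ =
        Y * X * o.σ * V * o.σ - Y * o.σ * V * o.σ * X := by
      rw [mul_sub, sub_mul]
      congr 1
      · rw [← mul_assoc, ← mul_assoc, ← mul_assoc, mul_assoc _ o.σ o.σ, o.σ_mul_σ, mul_one]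
      · rw [← mul_assoc, ← mul_assoc, ← mul_assoc, mul_assoc _ o.σ o.σ, o.σ_mul_σ, mul_one]
    have h2 : LinearMap.trace ℂ U ((Y : Module.End ℂ U) * o.σ * V * o.σ * X) =
        LinearMap.trace ℂ U ((X : Module.End ℂ U) * Y * o.σ * V * o.σ) := by
      rw [LinearMap.trace_mul_comm]
      simp only [mul_assoc]
    rw [h1, map_sub, h2, sub_mul, sub_mul, sub_mul, map_sub, Complex.sub_re, Complex.sub_re]
    ring
  θ_Z := Subtype.ext (by
    have h := o.decomposition.Z_mem
    change o.σ * o.zEnd = o.zEnd * o.σ at h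
    change o.σ * o.zEnd * o.σ = o.zEnd
    rw [h, mul_assoc, o.σ_mul_σ, mul_one])
  lie_Z X := o.decomposition.lie_Z _ (by
    change o.σ * ((X : Module.End ℂ U) + o.σ * X * o.σ) = (X + o.σ * X * o.σ) * o.σ
    rw [mul_add, add_mul, ← mul_assoc, ← mul_assoc, o.σ_mul_σ, one_mul, mul_assoc _ o.σ o.σ,
      o.σ_mul_σ, mul_one, add_comm])
  lie_Z_Z X := o.decomposition.lie_Z_Z _ (by
    change o.σ * ((X : Module.End ℂ U) - o.σ * X * o.σ) = -((X - o.σ * X * o.σ) * o.σ)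
    rw [mul_sub, sub_mul, ← mul_assoc, ← mul_assoc, o.σ_mul_σ, one_mul, mul_assoc _ o.σ o.σ,
      o.σ_mul_σ, mul_one, neg_sub])
  center := hcenter

end SU

section StdForm

theorem stdForm_apply (p q : ℕ) (x y : Fin p ⊕ Fin q → ℂ) :
    stdForm p q x y = ∑ i, conj (x (Sum.inl i)) * y (Sum.inl i)
      - ∑ j, conj (x (Sum.inr j)) * y (Sum.inr j) := rfl

theorem stdForm_isSymm (p q : ℕ) : (stdForm p q).IsSymm :=
  ⟨fun x y => by simp [stdForm_apply, mul_comm]⟩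

/-- The base point of the standard form given by the coordinate subspaces. -/
noncomputable def stdBasePoint (p q : ℕ) : BasePoint (stdForm p q) where
  pos := ⨅ j, LinearMap.ker (LinearMap.proj (Sum.inr j))
  neg := ⨅ i, LinearMap.ker (LinearMap.proj (Sum.inl i))
  isCompl := by
    rw [isCompl_iff, Submodule.disjoint_def, codisjoint_iff, Submodule.eq_top_iff']
    simp only [Submodule.mem_iInf, LinearMap.mem_ker, LinearMap.proj_apply, Submodule.mem_sup]
    refine ⟨fun x hx hx' => ?_, fun x => ⟨Sum.elim (fun i => x (Sum.inl i)) 0, fun _ => rfl,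
      Sum.elim 0 (fun j => x (Sum.inr j)), fun _ => rfl, ?_⟩⟩
    · ext (i | j)
      · exact hx' i
      · exact hx j
    · ext (i | j) <;> simp
  orthogonal x hx y hy := by
    simp only [Submodule.mem_iInf, LinearMap.mem_ker, LinearMap.proj_apply] at hx hy
    simp [stdForm_apply, hx, hy]
  pos_def x hx hx0 := by
    simp only [Submodule.mem_iInf, LinearMap.mem_ker, LinearMap.proj_apply] at hx
    obtain ⟨i | j, hi⟩ := Function.ne_iff.1 hx0
    · simp only [stdForm_apply, hx, mul_zero, Finset.sum_const_zero, sub_zero,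
        ← Complex.normSq_eq_conj_mul_self, Complex.re_sum, Complex.ofReal_re]
      exact Finset.sum_pos' (fun i _ => Complex.normSq_nonneg _)
        ⟨i, Finset.mem_univ i, Complex.normSq_pos.2 hi⟩
    · exact absurd (hx j) hi
  neg_def x hx hx0 := by
    simp only [Submodule.mem_iInf, LinearMap.mem_ker, LinearMap.proj_apply] at hx
    obtain ⟨i | j, hi⟩ := Function.ne_iff.1 hx0
    · exact absurd (hx i) hi
    · simp only [stdForm_apply, hx, mul_zero, Finset.sum_const_zero, zero_sub,
        ← Complex.normSq_eq_conj_mul_self, Complex.neg_re, Complex.re_sum, Complex.ofReal_re]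
      exact neg_neg_of_pos (Finset.sum_pos' (fun i _ => Complex.normSq_nonneg _)
        ⟨j, Finset.mem_univ j, Complex.normSq_pos.2 hi⟩)

/-- The rank one operator `w ↦ F(v, w) u`. -/
noncomputable def rankOne {U : Type*} [AddCommGroup U] [Module ℂ U] (F : U →ₗ⋆[ℂ] U →ₗ[ℂ] ℂ)
    (u v : U) : Module.End ℂ U := (F v).smulRight u

/-- An element of the centre of `su(U, F)` commutes with the operators `w ↦ F(v, w) u` for
orthogonal `u`, `v`, since these lie in the complexification. -/
theorem comm_rankOne_of_center {U : Type*} [AddCommGroup U] [Module ℂ U] [FiniteDimensional ℂ U]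
    {F : U →ₗ⋆[ℂ] U →ₗ[ℂ] ℂ} (hF : F.IsSymm) {X : su F} (hX : ∀ Y : su F, ⁅X, Y⁆ = 0) {u v : U}
    (huv : F u v = 0) (w : U) :
    F v w • (X : Module.End ℂ U) u = F v ((X : Module.End ℂ U) w) • u := by
  have hvu : F v u = 0 := hF.isRefl _ _ huv
  have htr : ∀ u v : U, LinearMap.trace ℂ U (rankOne F u v) = F v u := fun u v =>
    LinearMap.trace_smulRight _ _
  have hmem : ∀ z : ℂ, z • rankOne F u v - conj z • rankOne F v u ∈ su F := by
    intro z
    refine ⟨fun x y => ?_, ?_⟩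
    · have h1 := hF.eq v x
      have h2 := hF.eq u x
      simp only [rankOne, LinearMap.sub_apply, LinearMap.smul_apply, LinearMap.smulRight_apply,
        map_sub, map_smulₛₗ, smul_eq_mul, RingHom.id_apply, h1, h2, Complex.conj_conj]
      ring
    · rw [map_sub, map_smul, map_smul, htr, htr, huv, hvu, smul_zero, smul_zero, sub_zero]
  have hcomm : ∀ z : ℂ, (X : Module.End ℂ U) * (z • rankOne F u v - conj z • rankOne F v u) =
      (z • rankOne F u v - conj z • rankOne F v u) * X := fun z =>
    sub_eq_zero.1 (congr_arg Subtype.val (hX ⟨_, hmem z⟩))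
  have h1 := LinearMap.congr_fun (hcomm 1) w
  have h2 := LinearMap.congr_fun (hcomm Complex.I) w
  simp only [rankOne, Module.End.mul_apply, LinearMap.sub_apply, LinearMap.smul_apply,
    LinearMap.smulRight_apply, map_sub, map_smul, map_one, one_smul, Complex.conj_I] at h1 h2
  have h3 : (2 * Complex.I) • (F v w • (X : Module.End ℂ U) u) =
      (2 * Complex.I) • (F v ((X : Module.End ℂ U) w) • u) := by
    linear_combination (norm := module) Complex.I • h1 + h2
  exact smul_right_injective U (by simp : (2 * Complex.I) ≠ 0) h3

/-- The centre of `su(p, q)` is zero: a central element has each vector of the standard basis as an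
eigenvector, with the same eigenvalue, and has trace zero. -/
theorem center_su_stdForm {p q : ℕ} (hp : 1 ≤ p) (hq : 1 ≤ q) (X : su (stdForm p q))
    (hX : ∀ Y : su (stdForm p q), ⁅X, Y⁆ = 0) : X = 0 := by
  let b := Pi.basisFun ℂ (Fin p ⊕ Fin q)
  have hb : ∀ k l, stdForm p q (b k) (b l) =
      if k = l then Sum.elim (fun _ => (1 : ℂ)) (fun _ => -1) k else 0 := fun k l => by
    simp only [b, Pi.basisFun_apply, stdForm_single]
  let η : Fin p ⊕ Fin q → ℂ := Sum.elim (fun _ => 1) (fun _ => -1)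
  have hη : ∀ k, η k * η k = 1 := by rintro (k | k) <;> simp [η]
  let lam : Fin p ⊕ Fin q → ℂ := fun l => η l * stdForm p q (b l) ((X : Module.End ℂ _) (b l))
  -- each basis vector is an eigenvector, with the eigenvalue read off from any other one
  have h1 : ∀ k l, k ≠ l → (X : Module.End ℂ _) (b k) = lam l • b k := by
    intro k l hkl
    have h := comm_rankOne_of_center (stdForm_isSymm p q) hX
      (u := b k) (v := b l) (by rw [hb, if_neg hkl]) (b l)
    rw [hb, if_pos rfl] at h
    change η l • _ = _ at h
    rw [mul_smul, ← h, smul_smul, hη, one_smul]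
  have h2 : ∀ k l, k ≠ l → lam k = lam l := by
    intro k l hkl
    have : lam k = η k * stdForm p q (b k) ((X : Module.End ℂ _) (b k)) := rfl
    rw [this, h1 k l hkl, map_smul, hb, if_pos rfl, smul_eq_mul, mul_left_comm]
    change lam l * (η k * η k) = lam l
    rw [hη, mul_one]
  let k₀ : Fin p ⊕ Fin q := Sum.inl ⟨0, hp⟩
  let l₀ : Fin p ⊕ Fin q := Sum.inr ⟨0, hq⟩
  have h3 : (X : Module.End ℂ (Fin p ⊕ Fin q → ℂ)) = lam k₀ • 1 := by
    refine b.ext fun k => ?_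
    by_cases hk : k = k₀
    · rw [hk, h1 k₀ l₀ Sum.inl_ne_inr, ← h2 k₀ l₀ Sum.inl_ne_inr]; rfl
    · rw [h1 k k₀ hk]; rfl
  have h4 := X.2.2
  rw [h3, map_smul, LinearMap.trace_one, smul_eq_mul, mul_eq_zero] at h4
  have h5 : ((Module.finrank ℂ (Fin p ⊕ Fin q → ℂ) : ℕ) : ℂ) ≠ 0 := by
    rw [Module.finrank_fintype_fun_eq_card, Fintype.card_sum, Fintype.card_fin, Fintype.card_fin]
    exact_mod_cast (by omega : p + q ≠ 0)
  refine Subtype.ext ?_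
  rw [h3, h4.resolve_right h5, zero_smul]
  rfl

end StdForm

/-! ### Cartan data of the symplectic algebras -/

section Symplectic

open Matrix

theorem mem_sp_iff {m : ℕ} {X : Matrix (Fin m ⊕ Fin m) (Fin m ⊕ Fin m) ℝ} :
    X ∈ LieAlgebra.Symplectic.sp (Fin m) ℝ ↔ Xᵀ * J (Fin m) ℝ = -(J (Fin m) ℝ * X) := by
  rw [LieAlgebra.Symplectic.sp, mem_skewAdjointMatricesLieSubalgebra,
    mem_skewAdjointMatricesSubmodule, Matrix.IsSkewAdjoint, Matrix.IsAdjointPair, mul_neg]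

theorem transpose_mem_sp {m : ℕ} {X : Matrix (Fin m ⊕ Fin m) (Fin m ⊕ Fin m) ℝ}
    (hX : X ∈ LieAlgebra.Symplectic.sp (Fin m) ℝ) : Xᵀ ∈ LieAlgebra.Symplectic.sp (Fin m) ℝ := by
  rw [mem_sp_iff] at hX ⊢
  have hJ := J_squared (Fin m) ℝ
  have h : Xᵀ = J (Fin m) ℝ * X * J (Fin m) ℝ := by
    have := congr_arg (· * J (Fin m) ℝ) hX
    simp only [mul_assoc, hJ, mul_neg, mul_one, neg_mul] at this
    rw [mul_assoc]
    exact neg_injective this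
  rw [transpose_transpose, h, ← mul_assoc, ← mul_assoc, hJ, neg_mul, one_mul, neg_mul, neg_neg]

/-- The centre of `sp(2m, ℝ)` is zero: commuting with the elements `E J`, where `E` is a diagonal
matrix unit, forces all entries to vanish. -/
theorem center_sp {m : ℕ} (X : LieAlgebra.Symplectic.sp (Fin m) ℝ)
    (hX : ∀ Y : LieAlgebra.Symplectic.sp (Fin m) ℝ, ⁅X, Y⁆ = 0) : X = 0 := by
  have hJ := J_squared (Fin m) ℝ
  have hJT := J_transpose (Fin m) ℝ
  have hXJ := mem_sp_iff.1 X.2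
  have h1 : ∀ a, X.1 * single a a 1 = -(single a a 1 * X.1ᵀ) := by
    intro a
    have hmem : single a a 1 * J (Fin m) ℝ ∈ LieAlgebra.Symplectic.sp (Fin m) ℝ := by
      rw [mem_sp_iff, transpose_mul, transpose_single, hJT, neg_mul, neg_mul, mul_assoc]
    have h2 : X.1 * (single a a 1 * J (Fin m) ℝ) - single a a 1 * J (Fin m) ℝ * X.1 = 0 :=
      congr_arg Subtype.val (hX ⟨_, hmem⟩)
    have h4 : J (Fin m) ℝ * X.1 = -(X.1ᵀ * J (Fin m) ℝ) := by rw [hXJ, neg_neg]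
    rw [mul_assoc _ _ X.1, h4, mul_neg, sub_neg_eq_add, ← mul_assoc, ← mul_assoc, ← add_mul] at h2
    have h3 : (X.1 * single a a 1 + single a a 1 * X.1ᵀ) * (J (Fin m) ℝ * J (Fin m) ℝ) = 0 := by
      rw [← mul_assoc, h2, zero_mul]
    rw [hJ, mul_neg, mul_one, neg_eq_zero] at h3
    exact eq_neg_of_add_eq_zero_left h3
  refine Subtype.ext (Matrix.ext fun i a => ?_)
  have h2 := congr_fun (congr_fun (h1 a) i) a
  by_cases hia : i = a
  · subst hia
    simp at h2
    change X.1 i i = 0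
    linarith
  · simpa [hia] using h2

/-- The Cartan data of `sp(2m, ℝ)`: the inner product is `tr(X Yᵀ)`, the Cartan involution is
`X ↦ -Xᵀ`, and the complex structure is induced by `J / 2`. -/
noncomputable def cartanDataSp (m : ℕ) : CartanData (LieAlgebra.Symplectic.sp (Fin m) ℝ) where
  P := LinearMap.mk₂ ℝ (fun X Y => trace (X.1 * Y.1ᵀ))
    (fun X X' Y => by simp [add_mul]) (fun r X Y => by simp)
    (fun X Y Y' => by simp [mul_add]) (fun r X Y => by simp)
  θ :=
    { toFun := fun X => ⟨-X.1ᵀ, neg_mem (transpose_mem_sp X.2)⟩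
      map_add' := fun X Y => Subtype.ext (by simp [add_comm])
      map_smul' := fun r X => Subtype.ext (by simp) }
  Z := ⟨(1 / 2 : ℝ) • J (Fin m) ℝ, by
    rw [mem_sp_iff, transpose_smul, J_transpose]
    simp⟩
  finite := FiniteDimensional.finiteDimensional_submodule
    (LieAlgebra.Symplectic.sp (Fin m) ℝ).toSubmodule
  symm X Y := by
    simp only [LinearMap.mk₂_apply]
    rw [← trace_transpose, transpose_mul, transpose_transpose]
  pos X hX := by
    simp only [LinearMap.mk₂_apply, trace, diag_apply, mul_apply, transpose_apply]
    have hne : ∃ i j, X.1 i j ≠ 0 := by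
      by_contra! h
      exact hX (Subtype.ext (Matrix.ext h))
    obtain ⟨i, j, hij⟩ := hne
    refine Finset.sum_pos' (fun i _ => Finset.sum_nonneg fun j _ => mul_self_nonneg _)
      ⟨i, Finset.mem_univ i, Finset.sum_pos' (fun j _ => mul_self_nonneg _)
        ⟨j, Finset.mem_univ j, mul_self_pos.2 hij⟩⟩
  θ_θ X := Subtype.ext (by simp)
  θ_lie X Y := Subtype.ext (by
    change -(X.1 * Y.1 - Y.1 * X.1)ᵀ = -X.1ᵀ * -Y.1ᵀ - -Y.1ᵀ * -X.1ᵀ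
    rw [transpose_sub, transpose_mul, transpose_mul]
    noncomm_ring)
  P_θ X Y := by
    change trace (-X.1ᵀ * Y.1ᵀ) = trace (X.1 * (-Y.1ᵀ)ᵀ)
    rw [← trace_transpose, transpose_mul, transpose_neg, transpose_neg, transpose_transpose,
      transpose_transpose, trace_mul_comm, neg_mul, mul_neg]
  P_lie X Y V := by
    change trace ((X.1 * Y.1 - Y.1 * X.1) * V.1ᵀ) =
      -trace (Y.1 * (-X.1ᵀ * V.1 - V.1 * -X.1ᵀ)ᵀ)
    have h : (-X.1ᵀ * V.1 - V.1 * -X.1ᵀ)ᵀ = X.1 * V.1ᵀ - V.1ᵀ * X.1 := by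
      simp only [transpose_sub, transpose_mul, transpose_neg, transpose_transpose]
      noncomm_ring
    rw [h, sub_mul, mul_sub, trace_sub, trace_sub, mul_assoc X.1, trace_mul_comm X.1, mul_assoc,
      mul_assoc]
    ring
  θ_Z := Subtype.ext (by
    change -((1 / 2 : ℝ) • J (Fin m) ℝ)ᵀ = (1 / 2 : ℝ) • J (Fin m) ℝ
    rw [transpose_smul, J_transpose]
    simp)
  lie_Z X := Subtype.ext (by
    have h1 := mem_sp_iff.1 X.2
    have h2 := mem_sp_iff.1 (transpose_mem_sp X.2)
    rw [transpose_transpose] at h2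
    change (1 / 2 : ℝ) • J (Fin m) ℝ * (X.1 + -X.1ᵀ) - (X.1 + -X.1ᵀ) * (1 / 2 : ℝ) • J (Fin m) ℝ = 0
    rw [smul_mul_assoc, mul_smul_comm, ← smul_sub, mul_add, add_mul, mul_neg, neg_mul, h1, h2,
      neg_neg, add_comm, sub_self, smul_zero])
  lie_Z_Z X := Subtype.ext (by
    have hJ := J_squared (Fin m) ℝ
    have h1 := mem_sp_iff.1 X.2
    have h2 := mem_sp_iff.1 (transpose_mem_sp X.2)
    rw [transpose_transpose] at h2
    set Y := X.1 - -X.1ᵀ with hY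
    have h3 : Y * J (Fin m) ℝ = -(J (Fin m) ℝ * Y) := by
      rw [hY, sub_mul, neg_mul, h1, h2, mul_sub, mul_neg]
      abel
    set K := (1 / 2 : ℝ) • J (Fin m) ℝ with hK
    change K * (K * Y - Y * K) - (K * Y - Y * K) * K = -Y
    have h4 : Y * K = -(K * Y) := by
      rw [hK, mul_smul_comm, h3, smul_mul_assoc, smul_neg]
    have h5 : K * K = (-1 / 4 : ℝ) • 1 := by
      rw [hK, smul_mul_smul_comm, hJ, smul_neg, ← neg_smul]
      norm_num
    have h6 : K * (K * Y - Y * K) - (K * Y - Y * K) * K = (4 : ℝ) • (K * K * Y) := by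
      rw [h4, sub_neg_eq_add, mul_add, add_mul, mul_assoc K Y K, h4]
      simp only [mul_neg, ← mul_assoc]
      module
    rw [h6, h5, smul_mul_assoc, one_mul, smul_smul]
    norm_num)
  center := center_sp

end Symplectic

theorem IsSuOrSp.nonempty_cartanData {L : Type*} [LieRing L] [LieAlgebra ℝ L] (h : IsSuOrSp L) :
    Nonempty (CartanData L) := by
  obtain ⟨p, q, hp, hq, ⟨f⟩⟩ | ⟨m, -, ⟨f⟩⟩ := h
  · exact ⟨((stdBasePoint p q).cartanData (stdForm_isSymm p q) (center_su_stdForm hp hq)).ofEquiv f⟩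
  · exact ⟨(cartanDataSp m).ofEquiv f⟩

theorem OnlySuSpFactors.nonempty_compactFrame {L : Type*} [LieRing L] [LieAlgebra ℝ L]
    (h : OnlySuSpFactors L) : Nonempty (CompactFrame L) := by
  obtain ⟨k, I, hI, hI'⟩ := h
  obtain ⟨f⟩ := nonempty_equiv_directSum_of_isInternal hI
  exact ((CartanData.directSum fun i => (hI' i).nonempty_cartanData.some).ofEquiv
    f).nonempty_compactFrame

/-! ### Decomposition of representations in `su(U, F)` -/

section Components

variable {L : Type*} [LieRing L] [LieAlgebra ℝ L] {U : Type*} [AddCommGroup U] [Module ℂ U]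
  {F : U →ₗ⋆[ℂ] U →ₗ[ℂ] ℂ}

/-- The homomorphism into `⨁ su(Wᵢ, F|Wᵢ)` given by the restrictions to invariant subspaces. The
restrictions have trace zero because `L` is perfect. -/
noncomputable def CompactFrame.components (D : CompactFrame L) (ρ : L →ₗ⁅ℝ⁆ su F) {n : ℕ}
    (W : Fin n → Submodule ℂ U)
    (hW : ∀ i, ∀ x, ∀ w ∈ W i, (su F).incl.comp ρ x w ∈ W i) :
    L →ₗ⁅ℝ⁆ ⨁ i, su (restrict F (W i)) where
  toFun x := DFinsupp.equivFunOnFintype.symm fun i =>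
    ⟨restrictRep ((su F).incl.comp ρ) (W i) (hW i) x,
      fun u v => (ρ x).2.1 u v, D.trace_eq_zero (restrictRep ((su F).incl.comp ρ) (W i) (hW i)) x⟩
  map_add' x y := DFinsupp.ext fun i => Subtype.ext (map_add (restrictRep _ (W i) (hW i)) x y)
  map_smul' r x := DFinsupp.ext fun i => Subtype.ext (map_smul (restrictRep _ (W i) (hW i)) r x)
  map_lie' {x y} := DFinsupp.ext fun i => by
    rw [DirectSum.bracket_apply]
    exact Subtype.ext (LieHom.map_lie (restrictRep _ (W i) (hW i)) x y)

theorem CompactFrame.isIrreducibleRep_component (D : CompactFrame L) (ρ : L →ₗ⁅ℝ⁆ su F) {n : ℕ}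
    (W : Fin n → Submodule ℂ U)
    (hW : ∀ i, IsIrreducibleNondegenerate ((su F).incl.comp ρ) F (W i)) (i : Fin n) :
    IsIrreducibleRep ((DirectSum.lieAlgebraComponent ℝ (Fin n)
      (fun i => su (restrict F (W i))) i).comp (D.components ρ W fun i => (hW i).invariant)) := by
  refine ⟨Submodule.nontrivial_iff_ne_bot.2 (hW i).ne_bot, fun V hV => ?_⟩
  have hinj := Submodule.map_injective_of_injective (W i).subtype_injective
  rcases (hW i).eq_bot_or_eq (V.map (W i).subtype) ((W i).map_subtype_le V) (by
    rintro x _ ⟨w, hw, rfl⟩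
    exact ⟨_, hV x w hw, rfl⟩) with h | h
  · exact Or.inl (hinj (by rw [h, Submodule.map_bot]))
  · exact Or.inr (hinj (by rw [h, Submodule.map_subtype_top]))

theorem eq_one_iff_isIrreducibleRep (ρ : L →ₗ⁅ℝ⁆ su F) {n : ℕ} {W : Fin n → Submodule ℂ U}
    (htop : ⨆ i, W i = ⊤) (horth : ∀ i j, i ≠ j → ∀ x ∈ W i, ∀ y ∈ W j, F x y = 0)
    (hW : ∀ i, IsIrreducibleNondegenerate ((su F).incl.comp ρ) F (W i)) :
    n = 1 ↔ IsIrreducibleRep ρ := by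
  constructor
  · rintro rfl
    have h0 : W 0 = ⊤ := by
      rw [← htop]
      exact (ciSup_unique (s := W)).symm
    refine ⟨(Submodule.nontrivial_iff ℂ).1 ⟨W 0, ⊥, (hW 0).ne_bot⟩, fun V hV => ?_⟩
    rw [← h0]
    exact (hW 0).eq_bot_or_eq V (h0 ▸ le_top) hV
  · rintro ⟨hU, hirr⟩
    have htop' : ∀ i, W i = ⊤ := fun i =>
      (hirr (W i) (hW i).invariant).resolve_left (hW i).ne_bot
    have hn : n ≠ 0 := by
      rintro rfl
      rw [iSup_of_empty] at htop
      exact bot_ne_top htop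
    by_contra hn1
    -- two summands would both be equal to `U` and orthogonal to each other
    let i : Fin n := ⟨0, by omega⟩
    let j : Fin n := ⟨1, by omega⟩
    have hij : i ≠ j := fun h => zero_ne_one (congr_arg Fin.val h)
    refine (hW i).ne_bot ((Submodule.eq_bot_iff _).2 fun x hx => ?_)
    exact (hW i).eq_zero x hx fun v _ => horth i j hij x hx v (by rw [htop' j]; trivial)

end Components

end Hermitian

theorem mainTheorem12 {U : Type*} [AddCommGroup U] [Module ℂ U] [FiniteDimensional ℂ U]
    (F : U →ₗ⋆[ℂ] U →ₗ[ℂ] ℂ) (hF : F.IsSymm) (hF' : F.Nondegenerate)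
    {𝔤 : Type*} [LieRing 𝔤] [LieAlgebra ℝ 𝔤] (h𝔤 : Hermitian.OnlySuSpFactors 𝔤)
    (ρ : 𝔤 →ₗ⁅ℝ⁆ Hermitian.su F) :
    ∃ (n : ℕ) (W : Fin n → Submodule ℂ U) (r s : Fin n → ℕ)
      (ρ' : 𝔤 →ₗ⁅ℝ⁆ ⨁ i, Hermitian.su (Hermitian.restrict F (W i)))
      (ι : (⨁ i, Hermitian.su (Hermitian.restrict F (W i))) →ₗ⁅ℝ⁆ Hermitian.su F),
      DirectSum.IsInternal W ∧
      (∀ i j, i ≠ j → ∀ x ∈ W i, ∀ y ∈ W j, F x y = 0) ∧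
      (∀ i, (Hermitian.restrict F (W i)).Nondegenerate) ∧
      (∀ i, Hermitian.HasSignature (Hermitian.restrict F (W i)) (r i) (s i)) ∧
      (∀ i, ∀ X : 𝔤, ∀ w ∈ W i, (ρ X : Module.End ℂ U) w ∈ W i) ∧
      (∀ i, Hermitian.IsIrreducibleRep ((DirectSum.lieAlgebraComponent ℝ (Fin n)
        (fun i => Hermitian.su (Hermitian.restrict F (W i))) i).comp ρ')) ∧
      -- `ι` is the block-diagonal inclusion
      (∀ X i, ∀ w : W i, (ι X : Module.End ℂ U) w = (X i : Module.End ℂ (W i)) w) ∧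
      Function.Injective ι ∧
      -- `ι` is holomorphic
      (∀ o : ∀ i, Hermitian.BasePoint (Hermitian.restrict F (W i)), ∃ o' : Hermitian.BasePoint F,
        Hermitian.IsHolomorphicAt
          (Hermitian.HermitianDecomposition.directSum fun i => (o i).decomposition)
          o'.decomposition ι) ∧
      ρ = ι.comp ρ' ∧
      (n = 1 ↔ Hermitian.IsIrreducibleRep ρ) := by
  obtain ⟨D⟩ := h𝔤.nonempty_compactFrame
  obtain ⟨n, W, htop, horth, hW⟩ := D.exists_orthogonal_decomposition ((Hermitian.su F).incl.comp ρ)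
    hF (fun x u v => (ρ x).2.1 u v) (Module.finrank ℂ U) ⊤ (finrank_top ℂ U).le
    (fun _ _ _ => trivial) fun w _ hw => hF'.1 w fun v => hw v trivial
  have hint := Hermitian.isInternal_of_orthogonal hF htop horth fun i => (hW i).eq_zero
  have hsymm : ∀ i, (Hermitian.restrict F (W i)).IsSymm := fun i => hF.domRestrict (W i)
  have hsep : ∀ i, (Hermitian.restrict F (W i)).SeparatingLeft := fun i w hw =>
    Subtype.ext ((hW i).eq_zero w w.2 fun v hv => hw ⟨v, hv⟩)
  choose r s hrs using fun i => Hermitian.exists_hasSignature (hsymm i) (hsep i)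
  refine ⟨n, W, r, s, D.components ρ W fun i => (hW i).invariant,
    Hermitian.blockInclusion hint horth, hint, horth,
    fun i => ⟨hsep i, fun w hw => hsep i w fun v => (hsymm i).isRefl _ _ (hw v)⟩, hrs,
    fun i => (hW i).invariant, D.isIrreducibleRep_component ρ W hW,
    fun X i w => Hermitian.blockDiag_apply hint (fun i => (X i).1) w,
    Hermitian.blockInclusion_injective hint horth,
    fun o => ⟨_, Hermitian.isHolomorphicAt_blockInclusion hint horth o⟩, ?_,
    Hermitian.eq_one_iff_isIrreducibleRep ρ htop horth hW⟩
  exact LieHom.ext fun x => Subtype.ext (Hermitian.eq_blockDiag hint fun i w => rfl)
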